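/- **Definitions.** A $\mathbb{Z}^2$-subshift over a finite alphabet $\mathcal{A}$ is a closed subset $X\subseteq\mathcal{A}^{\mathbb{Z}^2}$ (product topology, $\mathcal{A}$ discrete) that is invariant under all shifts $(\sigma_v x)_p=x_{p-v}$, $v\in\mathbb{Z}^2$; it is minimal if it is nonempty and every point of $X$ has a dense shift orbit in $X$. The extended symmetry group $\mathrm{Sym}(X,\mathbb{Z}^2)$ is the group, under composition, of all homeomorphisms $f:X\to X$ for which there is $A\in\mathrm{GL}_2(\mathbb{Z})$ with $f\circ\sigma_v=\sigma_{Av}\circ f$ for all $v\in\mathbb{Z}^2$. The Robinson tiles are the $28$ rotations and reflections of the following five unit squares $[0,1]^2$ decorated with black and red arrows. 1. A black main arrow from $(\tfrac12,1)$ to $(\tfrac12,0)$, and two black side arrows entering at $(0,\tfrac12)$ and at $(1,\tfrac12)$ and ending at the main arrow. 2. Tile 1, with in addition a red arrow from $(\tfrac14,1)$ to $(\tfrac14,0)$ and two red side arrows entering horizontally at $(0,\tfrac14)$ and at $(1,\tfrac14)$ and ending inside the tile. 3. (The *cross*.) Four black arrows with their heads at the midpoints of the four sides, and a red L-shaped arrow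 through $(\tfrac14,1),(\tfrac14,\tfrac14),(1,\tfrac14)$ with heads at its two ends $(\tfrac14,1)$ and $(1,\tfrac14)$. 4. Tile 1, with in addition the two red side arrows of tile 2. 5. Tile 1, with in addition the red arrow from $(\tfrac14,1)$ to $(\tfrac14,0)$. The Robinson shift $X_{\mathrm{Rob}}$ is the set of all configurations $x$ of these tiles on $\mathbb{Z}^2$ such that (1) on the common side of any two adjacent tiles, each arrow head of either tile meets, at the same point, an arrow tail of the same colour of the other tile, and each arrow tail meets an arrow head in the same way; and, for some $k\in\mathbb{Z}^2$, (2) all tiles at positions in $k+2\mathbb{Z}^2$ are crosses, and (3) every other cross lies at a position in $k+(1,1)+2\mathbb{Z}^2$. **Statement.** There is exactly one minimal subshift $M_{\mathrm{Rob}}\subseteq X_{\mathrm{Rob}}$, and $$\mathrm{Sym}(M_{\mathrm{Rob}},\mathbb{Z}^2)\cong\mathbb{Z}^2\rtimes D_4,$$ where $D_4$ is the dihedral group of order $8$, acting on $\mathbb{Z}^2$ in the standard way as the group of matrices generated by $\begin{bmatrix}0&-1\\1&0\end{bmatrix}$ and $\begin{bmatrix}-1&0\\0&1\end{bmatrix}$.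 -/

import Mathlib

namespace Robinson

open Matrix

/-! ### Subshifts of `A^(ℤ^d)` and their extended symmetries -/

/-- The lattice `ℤ^d`. -/
abbrev Lattice (d : ℕ) : Type := Fin d → ℤ

/-- The full shift `A^(ℤ^d)`; for a discrete alphabet it carries the product topology. -/
abbrev Config (A : Type) (d : ℕ) : Type := Lattice d → A

/-- The shift action `(σ_v x)_p = x_(p - v)`. -/
def shift {A : Type} {d : ℕ} (v : Lattice d) (x : Config A d) : Config A d :=
  fun p => x (p - v)

/-- A subshift: a closed, shift-invariant set of configurations. -/
structure Subshift (A : Type) [TopologicalSpace A] (d : ℕ) where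
  carrier : Set (Config A d)
  isClosed : IsClosed carrier
  shift_mem : ∀ (v : Lattice d) (x : Config A d), x ∈ carrier → shift v x ∈ carrier

namespace Subshift

variable {A : Type} [TopologicalSpace A] {d : ℕ}

/-- A subshift is minimal if it is nonempty and each of its points has a dense orbit in it. -/
def IsMinimal (X : Subshift A d) : Prop :=
  X.carrier.Nonempty ∧
    ∀ x ∈ X.carrier, X.carrier ⊆ closure (Set.range fun v : Lattice d => shift v x)

/-- The shift `σ_v` as a self-map of a subshift. -/
def shiftMap (X : Subshift A d) (v : Lattice d) (x : X.carrier) : X.carrier :=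
  ⟨shift v x.1, X.shift_mem v x.1 x.2⟩

/-- `f ∘ σ_v = σ_(M v) ∘ f` for all `v ∈ ℤ^d`. -/
def IsMorphism (X : Subshift A d) (M : GL (Fin d) ℤ) (f : X.carrier → X.carrier) : Prop :=
  ∀ (v : Lattice d) (x : X.carrier), f (X.shiftMap v x) = X.shiftMap (M.1 *ᵥ v) (f x)

/-- The group of extended symmetries: the self-homeomorphisms of `X` that satisfy
`f ∘ σ_v = σ_(M v) ∘ f` for some `M ∈ GL_d(ℤ)`, under composition. (For a finite discrete
alphabet `X` is compact Hausdorff, so continuous bijections of `X` are homeomorphisms.) -/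
def Sym (X : Subshift A d) : Subgroup (X.carrier ≃ₜ X.carrier) where
  carrier := {f | ∃ M : GL (Fin d) ℤ, X.IsMorphism M f}
  one_mem' := ⟨1, fun v x => by simp⟩
  mul_mem' := by
    rintro f g ⟨M, hM⟩ ⟨N, hN⟩
    refine ⟨M * N, fun v x => ?_⟩
    have h : f (g (X.shiftMap v x)) = X.shiftMap ((M * N).1 *ᵥ v) (f (g x)) := by
      rw [hN v x, hM, Matrix.mulVec_mulVec]
      rfl
    exact h
  inv_mem' := by
    rintro f ⟨M, hM⟩
    refine ⟨M⁻¹, fun v x => ?_⟩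
    have h : f.symm (X.shiftMap v x) = X.shiftMap ((M⁻¹).1 *ᵥ v) (f.symm x) := by
      apply f.injective
      rw [hM, Matrix.mulVec_mulVec, ← Units.val_mul, mul_inv_cancel]
      simp
    exact h

end Subshift

/-! ### The Robinson tiles -/

/-- The four directions, which also name the four sides of a unit square: `vert` tells
vertical from horizontal, `pos` tells north/east from south/west. -/
structure Dir where
  vert : Bool
  pos : Bool
deriving DecidableEq, Fintype

namespace Dir

def opp (d : Dir) : Dir := ⟨d.vert, !d.pos⟩

/-- One of the two directions perpendicular to `d`. -/
def perp (d : Dir) (s : Bool) : Dir := ⟨!d.vert, s⟩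

/-- The unit vector of a direction; coordinate `0` is horizontal, coordinate `1` vertical. -/
def vec (d : Dir) : Lattice 2 :=
  Pi.single (if d.vert then 1 else 0) (if d.pos then 1 else -1)

end Dir

/-- What is drawn on one side of a tile. Every side of every tile is met at its midpoint by
exactly one black arrow, by its head (`head = true`) or by its tail (`head = false`).
In addition there may be a red arrow, always parallel to the black one and with the same
sense; `red = some t` means that it meets the side at the point a quarter of the side length
away from the midpoint in the direction `t`. -/
structure Mark where
  head : Bool
  red : Option Dir
deriving DecidableEq

/-- The `28` rotations and reflections of the five Robinson tiles.

`cross a b`: four black arrow heads, one on each side, and a red L-shaped two-headed arrow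
that points to the horizontal direction `⟨false, a⟩` and to the vertical direction
`⟨true, b⟩`, its corner lying in the opposite quarter of the tile.

`arm m r s`: a black main arrow that crosses the tile in the direction `m`, and two black side
arrows that enter through the two other sides and end at the main arrow. If `r = some t`, a red
arrow runs parallel to the main arrow, displaced in the direction `m.perp t`. If `s` holds, each
of the two side arrows has a parallel red arrow, displaced in the direction `m`. The values
`(none, false)`, `(some _, true)`, `(none, true)`, `(some _, false)` of `(r, s)` give the
first, second, fourth and fifth tile type; the cross is the third. -/
inductive Tile where
  | cross (a b : Bool)
  | arm (m : Dir) (r : Option Bool) (s : Bool)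
deriving DecidableEq

instance : TopologicalSpace Tile := ⊥

instance : DiscreteTopology Tile := ⟨rfl⟩

namespace Tile

def IsCross : Tile → Prop
  | cross _ _ => True
  | arm _ _ _ => False

/-- The drawing on the side `d` of a tile. -/
def mark : Tile → Dir → Mark
  | cross a b, d =>
      ⟨true,
        if d = ⟨false, a⟩ then some ⟨true, !b⟩
        else if d = ⟨true, b⟩ then some ⟨false, !a⟩
        else none⟩
  | arm m r s, d =>
      ⟨decide (d = m),
        if d.vert = m.vert then r.map m.perp
        else if s then some m
        else none⟩

/-- The tile `u` may be placed next to `t` in the direction `d`: on their common side, each arrow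
head of one of them meets an arrow tail of the same colour of the other, and conversely. -/
def Matches (t u : Tile) (d : Dir) : Prop :=
  (t.mark d).head = !(u.mark d.opp).head ∧ (t.mark d).red = (u.mark d.opp).red

end Tile

/-- The Robinson shift: (1) arrow heads meet arrow tails; for some `k`, (2) all tiles on
`k + 2ℤ²` are crosses and (3) all other crosses lie on `k + (1,1) + 2ℤ²`. -/
def robinsonShift : Set (Config Tile 2) :=
  {x | (∀ (p : Lattice 2) (d : Dir), (x p).Matches (x (p + d.vec)) d) ∧
    ∃ k : Lattice 2,
      (∀ q : Lattice 2, (x (k + 2 • q)).IsCross) ∧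
      ∀ p : Lattice 2, (x p).IsCross →
        (∃ q : Lattice 2, p = k + 2 • q) ∨ ∃ q : Lattice 2, p = k + 1 + 2 • q}

/-! ### The group `ℤ² ⋊ D₄` -/

/-- The action of `GL_d(ℤ)` on (the multiplicatively written group) `ℤ^d`. -/
def glAction (d : ℕ) : GL (Fin d) ℤ →* MulAut (Multiplicative (Lattice d)) where
  toFun M :=
    { toFun := fun v => Multiplicative.ofAdd (M.1 *ᵥ v.toAdd)
      invFun := fun v => Multiplicative.ofAdd ((M⁻¹).1 *ᵥ v.toAdd)
      left_inv := fun v => by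
        simp only [toAdd_ofAdd, Matrix.mulVec_mulVec, ← Units.val_mul, inv_mul_cancel]
        simp
      right_inv := fun v => by
        simp only [toAdd_ofAdd, Matrix.mulVec_mulVec, ← Units.val_mul, mul_inv_cancel]
        simp
      map_mul' := fun v w => by
        simp [Matrix.mulVec_add] }
  map_one' := by
    ext v
    simp
  map_mul' M N := by
    ext v
    simp [Matrix.mulVec_mulVec]

/-- The rotation by a quarter turn. -/
def rotMatrix : Matrix (Fin 2) (Fin 2) ℤ := !![0, -1; 1, 0]

/-- The reflection that reverses the first coordinate. -/
def reflMatrix : Matrix (Fin 2) (Fin 2) ℤ := !![-1, 0; 0, 1]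

/-- The standard representation of the dihedral group of order `8` by integer matrices. -/
def dihedralMatrix : DihedralGroup 4 →* Matrix (Fin 2) (Fin 2) ℤ where
  toFun
    | .r i => rotMatrix ^ i.val
    | .sr i => reflMatrix * rotMatrix ^ i.val
  map_one' := by decide
  map_mul' := by decide

/-- The standard action of the dihedral group of order `8` on `ℤ²`. -/
def dihedralAction : DihedralGroup 4 →* MulAut (Multiplicative (Lattice 2)) :=
  (glAction 2).comp dihedralMatrix.toHomUnits

end Robinson

/-!
Off the two coordinate axes, `ℤ²` carries an explicit tiling: the tile at `(a, b)` depends only on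
the exponents of `2` in `a` and `b` and on the binary digits above them, and it is a cross exactly
where the exponents agree. Let `M` (`rob`) be the set of configurations all of whose patterns occur
in this tiling off the axes.

In an arbitrary point of the Robinson shift, the red corners of the crosses force four supertiles
of side `2 ^ n - 1` to assemble around a cross into one of side `2 ^ (n + 1) - 1`, and the
supertiles are patches of the explicit tiling. Hence every orbit closure in the Robinson shift
contains `M`, so `M` is the only minimal subshift.

A pattern of `M` determines its position in the hierarchy modulo powers of `2`. Points with the
same positions differ only along singular lines, where all powers of `2` divide a coordinate of the
position, and there they differ along a whole ray. A symmetry is a sliding block code, so it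
preserves equality of positions and maps two points that differ along one axis to points that
differ along a parallel of a coordinate axis. Therefore its linear part is a signed permutation
matrix `g`, and it maps points singular along both axes to points whose singular lines cross at
one point `w`. The affine map `(g, w)` determines the symmetry because every pattern occurs off the
axes; shifts and reflections realize all affine maps.
-/

namespace Robinson

open Matrix

/-! ### Subshifts and cylinders -/

section SymbolicDynamics

variable {A : Type} {d : ℕ}

theorem shift_shift (v w : Lattice d) (x : Config A d) :
    shift v (shift w x) = shift (v + w) x := by
  ext p
  simp only [shift, sub_sub]

theorem shift_zero (x : Config A d) : shift 0 x = x := by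
  ext p
  simp only [shift, sub_zero]

theorem shift_neg_shift (v : Lattice d) (x : Config A d) : shift (-v) (shift v x) = x := by
  rw [shift_shift, neg_add_cancel, shift_zero]

theorem shift_shift_neg (v : Lattice d) (x : Config A d) : shift v (shift (-v) x) = x := by
  rw [shift_shift, add_neg_cancel, shift_zero]

/-- The cube of lattice points whose coordinates are at most `N` in absolute value. Agreement on
`box d N` for growing `N` is convergence in the full shift. -/
def box (d N : ℕ) : Set (Lattice d) := {p | ∀ i, |p i| ≤ N}

theorem finite_box (N : ℕ) : (box d N).Finite :=
  (Set.finite_Icc (fun _ : Fin d => -(N : ℤ)) fun _ => (N : ℤ)).subset fun _ hp =>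
    ⟨fun i => (abs_le.1 (hp i)).1, fun i => (abs_le.1 (hp i)).2⟩

theorem box_mono {N N' : ℕ} (h : N ≤ N') : box d N ⊆ box d N' :=
  fun _ hp i => (hp i).trans (by exact_mod_cast h)

theorem exists_mem_box (p : Lattice d) : ∃ N, p ∈ box d N :=
  ⟨∑ i, (p i).natAbs, fun i => by
    rw [Int.abs_eq_natAbs]
    exact_mod_cast Finset.single_le_sum (f := fun i => (p i).natAbs) (fun _ _ => Nat.zero_le _)
      (Finset.mem_univ i)⟩

theorem add_mem_box {N N' : ℕ} {p q : Lattice d} (hp : p ∈ box d N) (hq : q ∈ box d N') :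
    p + q ∈ box d (N + N') := fun i => by
  push_cast
  exact (abs_add_le _ _).trans (add_le_add (hp i) (hq i))

theorem sub_mem_box {N N' : ℕ} {p q : Lattice d} (hp : p ∈ box d N) (hq : q ∈ box d N') :
    p - q ∈ box d (N + N') := fun i => by
  push_cast
  exact (abs_sub _ _).trans (add_le_add (hp i) (hq i))

variable [TopologicalSpace A]

theorem isOpen_setOf_eqOn_box [DiscreteTopology A] (N : ℕ) (y : Config A d) :
    IsOpen {z : Config A d | Set.EqOn z y (box d N)} :=
  isOpen_set_pi (finite_box N) fun p _ => isOpen_discrete {y p}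

theorem exists_eqOn_box_imp_mem {U : Set (Config A d)} (hU : IsOpen U) {y : Config A d}
    (hy : y ∈ U) : ∃ N, ∀ z, Set.EqOn z y (box d N) → z ∈ U := by
  obtain ⟨I, u, hu, hIU⟩ := isOpen_pi_iff.1 hU y hy
  choose N hN using exists_mem_box (d := d)
  refine ⟨I.sup N, fun z hz => hIU fun p hp => ?_⟩
  rw [hz (box_mono (Finset.le_sup (f := N) hp) (hN p))]
  exact (hu p hp).2

theorem mem_closure_of_forall_eqOn_box {S : Set (Config A d)} {y : Config A d}
    (h : ∀ N, ∃ z ∈ S, Set.EqOn z y (box d N)) : y ∈ closure S := by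
  rw [mem_closure_iff]
  intro U hU hy
  obtain ⟨N, hN⟩ := exists_eqOn_box_imp_mem hU hy
  obtain ⟨z, hzS, hzy⟩ := h N
  exact ⟨z, hN z hzy, hzS⟩

namespace Subshift

variable (X : Subshift A d)

theorem exists_local_radius [DiscreteTopology A] {f : X.carrier → X.carrier}
    (hf : Continuous f) (x : X.carrier) :
    ∃ N, ∀ y : X.carrier, Set.EqOn y.1 x.1 (box d N) → (f y).1 0 = (f x).1 0 := by
  have hf0 : Continuous fun x : X.carrier => (f x).1 0 :=
    (continuous_apply 0).comp (continuous_subtype_val.comp hf)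
  obtain ⟨V, hV, hVf⟩ := isOpen_induced_iff.1 ((isOpen_discrete {(f x).1 0}).preimage hf0)
  have mem_V (y : X.carrier) : y.1 ∈ V ↔ (f y).1 0 = (f x).1 0 := Set.ext_iff.1 hVf y
  obtain ⟨N, hN⟩ := exists_eqOn_box_imp_mem hV ((mem_V x).2 rfl)
  exact ⟨N, fun y hy => (mem_V y).1 (hN y.1 hy)⟩

/-- The radius of the local rule of a sliding block code: the letter of `f x` at the origin depends
only on the pattern of `x` on `box d R`. -/
def HasRadius (f : X.carrier → X.carrier) (R : ℕ) : Prop :=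
  ∀ x y : X.carrier, Set.EqOn x.1 y.1 (box d R) → (f x).1 0 = (f y).1 0

/-- The Curtis–Hedlund–Lyndon theorem. -/
theorem exists_hasRadius [DiscreteTopology A] [Finite A] {f : X.carrier → X.carrier}
    (hf : Continuous f) : ∃ R, X.HasRadius f R := by
  have : CompactSpace X.carrier := isCompact_iff_compactSpace.1 X.isClosed.isCompact
  choose N hN using X.exists_local_radius hf
  obtain ⟨t, ht⟩ := isCompact_univ.elim_finite_subcover
    (fun x : X.carrier => Subtype.val ⁻¹' {z | Set.EqOn z x.1 (box d (N x))})
    (fun x => (isOpen_setOf_eqOn_box (N x) x.1).preimage continuous_subtype_val)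
    fun x _ => Set.mem_iUnion.2 ⟨x, fun _ _ => rfl⟩
  refine ⟨t.sup N, fun x y hxy => ?_⟩
  obtain ⟨w, hw, hxw⟩ := Set.mem_iUnion₂.1 (ht (Set.mem_univ x))
  have hyx : Set.EqOn y.1 x.1 (box d (N w)) :=
    (hxy.mono (box_mono (Finset.le_sup (f := N) hw))).symm
  rw [hN w x hxw, hN w y (hyx.trans hxw)]

variable {X}

theorem closure_orbit_subset {x : Config A d} (hx : x ∈ X.carrier) :
    closure (Set.range fun v : Lattice d => shift v x) ⊆ X.carrier :=
  closure_minimal (Set.range_subset_iff.2 fun v => X.shift_mem v x hx) X.isClosed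

theorem eq_of_isMinimal_of_subset_closure_orbit {M : Subshift A d} (hM : M.IsMinimal)
    {S : Set (Config A d)} (hMS : M.carrier ⊆ S) (hX : X.carrier.Nonempty)
    (hS : ∀ x ∈ S, X.carrier ⊆ closure (Set.range fun v : Lattice d => shift v x)) : M = X := by
  obtain ⟨x, hx⟩ := hM.1
  obtain ⟨y, hy⟩ := hX
  have hXM : X.carrier ⊆ M.carrier := (hS x (hMS hx)).trans (closure_orbit_subset hx)
  have hMX : M.carrier ⊆ X.carrier := (hM.2 y (hXM hy)).trans (closure_orbit_subset hy)
  cases M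
  cases X
  congr
  exact hMX.antisymm hXM

theorem IsMorphism.apply_eq {M : GL (Fin d) ℤ} {f : X.carrier → X.carrier}
    (hf : X.IsMorphism M f) (x : X.carrier) (q : Lattice d) :
    (f x).1 q = (f (X.shiftMap (-((M⁻¹).1 *ᵥ q)) x)).1 0 := by
  rw [hf, mulVec_neg, mulVec_mulVec, ← Units.val_mul, mul_inv_cancel, Units.val_one, one_mulVec]
  simp only [shiftMap, shift, sub_neg_eq_add, zero_add]

theorem HasRadius.exists_ne_of_apply_ne {M : GL (Fin d) ℤ} {f : X.carrier → X.carrier} {R : ℕ}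
    (hR : X.HasRadius f R) (hf : X.IsMorphism M f) {x y : X.carrier} {q : Lattice d}
    (hq : (f x).1 q ≠ (f y).1 q) :
    ∃ w ∈ box d R, x.1 ((M⁻¹).1 *ᵥ q + w) ≠ y.1 ((M⁻¹).1 *ᵥ q + w) := by
  by_contra! hxy
  refine hq ?_
  rw [hf.apply_eq x, hf.apply_eq y]
  refine hR _ _ fun p hp => ?_
  simp only [shiftMap, shift, sub_neg_eq_add, add_comm p]
  exact hxy p hp

variable (X)

theorem continuous_shiftMap (v : Lattice d) : Continuous (X.shiftMap v) :=
  Continuous.subtype_mk (f := fun x : X.carrier => shift v x.1)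
    (continuous_pi fun p => (continuous_apply (p - v)).comp continuous_subtype_val) _

/-- The shift `σ_v` as a homeomorphism of a subshift. -/
def shiftHomeo (v : Lattice d) : X.carrier ≃ₜ X.carrier where
  toFun := X.shiftMap v
  invFun := X.shiftMap (-v)
  left_inv x := Subtype.ext (shift_neg_shift v x.1)
  right_inv x := Subtype.ext (shift_shift_neg v x.1)
  continuous_toFun := X.continuous_shiftMap v
  continuous_invFun := X.continuous_shiftMap (-v)

end Subshift

end SymbolicDynamics

/-! ### Dyadic valuations and digits -/

section Dyadic

variable {n K : ℕ} {a b d : ℤ}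

/-- The exponent of `2` in an integer; by convention `ord₂ 0 = 0`. -/
abbrev ord₂ (a : ℤ) : ℕ := padicValInt 2 a

theorem two_pow_dvd_iff_le_ord₂ (ha : a ≠ 0) (n : ℕ) : 2 ^ n ∣ a ↔ n ≤ ord₂ a := by
  simpa only [ha, false_or, Nat.cast_ofNat] using padicValInt_dvd_iff (p := 2) n a

theorem ne_zero_of_not_dvd (h : ¬ d ∣ a) : a ≠ 0 :=
  fun ha => h (ha ▸ dvd_zero d)

theorem not_two_pow_dvd_of_ord₂_lt (ha : a ≠ 0) (h : ord₂ a < n) : ¬ 2 ^ n ∣ a := by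
  rwa [two_pow_dvd_iff_le_ord₂ ha, not_le]

theorem ord₂_lt_of_not_dvd (h : ¬ 2 ^ n ∣ a) : ord₂ a < n := by
  rwa [two_pow_dvd_iff_le_ord₂ (ne_zero_of_not_dvd h), not_le] at h

theorem ord₂_eq_of_dvd_of_not_dvd (h : 2 ^ n ∣ a) (h' : ¬ 2 ^ (n + 1) ∣ a) : ord₂ a = n := by
  rw [two_pow_dvd_iff_le_ord₂ (ne_zero_of_not_dvd h')] at h
  exact le_antisymm (Nat.lt_succ_iff.1 (ord₂_lt_of_not_dvd h')) h

theorem ord₂_two_pow_mul_of_odd (n : ℕ) {c : ℤ} (hc : c % 2 = 1) : ord₂ (2 ^ n * c) = n := by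
  refine ord₂_eq_of_dvd_of_not_dvd (dvd_mul_right _ _) ?_
  rw [pow_succ, mul_dvd_mul_iff_left (by positivity)]
  omega

theorem ord₂_of_odd (ha : a % 2 = 1) : ord₂ a = 0 :=
  padicValInt.eq_zero_of_not_dvd (by omega)

theorem ord₂_neg (a : ℤ) : ord₂ (-a) = ord₂ a := by
  simp only [padicValInt, Int.natAbs_neg]

theorem ord₂_congr (h : 2 ^ K ∣ b - a) (ha : ¬ 2 ^ K ∣ a) : ord₂ b = ord₂ a := by
  have hlt := ord₂_lt_of_not_dvd ha
  have dvd_iff (n : ℕ) (hn : n ≤ K) : (2 : ℤ) ^ n ∣ b ↔ 2 ^ n ∣ a :=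
    (dvd_iff_dvd_of_dvd_sub ((pow_dvd_pow 2 hn).trans h))
  refine ord₂_eq_of_dvd_of_not_dvd ?_ ?_
  · exact (dvd_iff _ hlt.le).2 (padicValInt_dvd a)
  · rw [dvd_iff _ hlt]
    exact not_two_pow_dvd_of_ord₂_lt (ne_zero_of_not_dvd ha) (Nat.lt_succ_self _)

theorem testBit_eq_decide (a : ℤ) (n : ℕ) : a.testBit n = decide (a / 2 ^ n % 2 = 1) := by
  have natCast_div (m : ℕ) : ((m : ℤ) / 2 ^ n) = ((m / 2 ^ n : ℕ) : ℤ) := by push_cast; rfl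
  rcases a with m | m
  · change m.testBit n = _
    rw [Nat.testBit_eq_decide_div_mod_eq, Int.ofNat_eq_natCast, natCast_div, decide_eq_decide]
    omega
  · change (!m.testBit n) = _
    rw [Nat.testBit_eq_decide_div_mod_eq, Int.negSucc_ediv m (by positivity), ← decide_not,
      decide_eq_decide, ← Int.div_def, natCast_div]
    omega

theorem testBit_two_pow_mul_add {c : ℤ} (hb : 0 ≤ b) (hb' : b < 2 ^ n) :
    (2 ^ n * c + b).testBit n = decide (c % 2 = 1) := by
  rw [testBit_eq_decide, Int.mul_add_ediv_left _ _ (by positivity),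
    Int.ediv_eq_zero_of_lt hb hb', add_zero]

theorem testBit_two_pow_mul (n : ℕ) (c : ℤ) : (2 ^ n * c).testBit n = decide (c % 2 = 1) := by
  have hpos : (0 : ℤ) < 2 ^ n := by positivity
  simpa only [add_zero] using testBit_two_pow_mul_add (c := c) le_rfl hpos

theorem testBit_neg (h : ¬ 2 ^ n ∣ a) : (-a).testBit n = !a.testBit n := by
  rw [testBit_eq_decide, testBit_eq_decide, Int.neg_ediv, if_neg h,
    Int.sign_eq_one_of_pos (by positivity), ← decide_not, decide_eq_decide]
  omega

theorem testBit_add_one (h : ¬ 2 ^ n ∣ a + 1) : (a + 1).testBit n = a.testBit n := by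
  have hdiv := Int.mul_ediv_add_emod a (2 ^ n)
  have := Int.emod_nonneg a (b := 2 ^ n) (by positivity)
  have hlt := Int.emod_lt_of_pos a (b := 2 ^ n) (by positivity)
  have hne : a % 2 ^ n + 1 ≠ 2 ^ n := fun h' => h ⟨a / 2 ^ n + 1, by linarith⟩
  have hadd : a + 1 = 2 ^ n * (a / 2 ^ n) + (a % 2 ^ n + 1) := by linarith
  rw [hadd, testBit_two_pow_mul_add (by omega) (by omega), testBit_eq_decide]

theorem testBit_of_dvd_add_one (h : 2 ^ n ∣ a + 1) : a.testBit n = !(a + 1).testBit n := by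
  obtain ⟨c, hc⟩ := h
  have ha : a = 2 ^ n * (c - 1) + (2 ^ n - 1) := by linarith
  have hpos : (0 : ℤ) < 2 ^ n := by positivity
  rw [hc, testBit_two_pow_mul, ha, testBit_two_pow_mul_add (by omega) (by omega), ← decide_not,
    decide_eq_decide]
  omega

theorem testBit_of_dvd (h : 2 ^ n ∣ a) : a.testBit n = !decide (2 ^ (n + 1) ∣ a) := by
  obtain ⟨c, rfl⟩ := h
  rw [testBit_two_pow_mul, pow_succ, decide_eq_decide.2 (mul_dvd_mul_iff_left (by positivity)),
    ← decide_not, decide_eq_decide]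
  omega

theorem testBit_ord₂ (ha : a ≠ 0) : a.testBit (ord₂ a) = true := by
  rw [testBit_of_dvd (padicValInt_dvd a)]
  simpa using not_two_pow_dvd_of_ord₂_lt ha (Nat.lt_succ_self _)

theorem testBit_of_lt_ord₂ (ha : a ≠ 0) (h : n < ord₂ a) : a.testBit n = false := by
  rw [testBit_of_dvd ((two_pow_dvd_iff_le_ord₂ ha n).2 h.le)]
  simpa using (two_pow_dvd_iff_le_ord₂ ha (n + 1)).2 h

theorem testBit_congr (h : 2 ^ K ∣ b - a) (hn : n < K) : b.testBit n = a.testBit n := by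
  obtain ⟨c, hc⟩ : 2 ^ (n + 1) ∣ b - a := (pow_dvd_pow 2 hn).trans h
  have hb : b = 2 ^ n * (2 * c) + a := by linear_combination hc
  rw [hb, testBit_eq_decide, testBit_eq_decide, Int.mul_add_ediv_left _ _ (by positivity),
    decide_eq_decide]
  omega

end Dyadic

/-! ### Symmetries of the tiles and local constraints -/

local notation "west" => Dir.mk false false
local notation "east" => Dir.mk false true
local notation "south" => Dir.mk true false
local notation "north" => Dir.mk true true

namespace Dir

/-- The reflection of directions that exchanges east and west. -/
def mirror (d : Dir) : Dir := ⟨d.vert, if d.vert then d.pos else !d.pos⟩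

/-- The reflection of directions in the main diagonal. -/
def swap (d : Dir) : Dir := ⟨!d.vert, d.pos⟩

theorem opp_opp (d : Dir) : d.opp.opp = d := by
  simp only [opp, Bool.not_not]

theorem opp_mirror (d : Dir) : d.mirror.opp = d.opp.mirror := by
  revert d
  decide

end Dir

namespace Mark

/-- The reflection of side drawings that exchanges east and west. -/
def mirror (k : Mark) : Mark := ⟨k.head, k.red.map Dir.mirror⟩

/-- The reflection of side drawings in the main diagonal. -/
def swap (k : Mark) : Mark := ⟨k.head, k.red.map Dir.swap⟩

end Mark

namespace Tile

instance : Fintype Tile :=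
  Fintype.ofSurjective
    (Sum.elim (fun c : Bool × Bool => cross c.1 c.2)
      fun c : Dir × Option Bool × Bool => arm c.1 c.2.1 c.2.2) <| by
    rintro (⟨a, b⟩ | ⟨m, r, s⟩)
    exacts [⟨.inl (a, b), rfl⟩, ⟨.inr (m, r, s), rfl⟩]

/-- The reflection of tiles that exchanges east and west. -/
def mirror : Tile → Tile
  | cross a b => cross (!a) b
  | arm ⟨false, p⟩ r s => arm ⟨false, !p⟩ r s
  | arm ⟨true, p⟩ r s => arm ⟨true, p⟩ (r.map not) s

/-- The reflection of tiles in the main diagonal. -/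
def swap : Tile → Tile
  | cross a b => cross b a
  | arm m r s => arm m.swap r s

theorem mirror_mirror (t : Tile) : t.mirror.mirror = t := by
  revert t
  decide

theorem swap_swap (t : Tile) : t.swap.swap = t := by
  revert t
  decide

theorem mark_mirror (t : Tile) (d : Dir) : t.mirror.mark d.mirror = (t.mark d).mirror := by
  revert t d
  decide

theorem mark_swap (t : Tile) (d : Dir) : t.swap.mark d.swap = (t.mark d).swap := by
  revert t d
  decide

theorem IsCross.mirror {t : Tile} (h : t.IsCross) : t.mirror.IsCross := by
  rcases t with _ | _
  exacts [trivial, h.elim]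

theorem IsCross.swap {t : Tile} (h : t.IsCross) : t.swap.IsCross := by
  rcases t with _ | _
  exacts [trivial, h.elim]

theorem Matches.symm {t u : Tile} {d : Dir} (h : t.Matches u d) : u.Matches t d.opp := by
  rw [Matches, Dir.opp_opp, h.1, h.2, Bool.not_not]
  exact ⟨rfl, rfl⟩

theorem Matches.mirror {t u : Tile} {d : Dir} (h : t.Matches u d) :
    t.mirror.Matches u.mirror d.mirror := by
  rw [Matches, Dir.opp_mirror, mark_mirror, mark_mirror]
  exact ⟨h.1, congrArg (Option.map Dir.mirror) h.2⟩

theorem Matches.swap {t u : Tile} {d : Dir} (h : t.Matches u d) :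
    t.swap.Matches u.swap d.swap := by
  rw [Matches, show d.swap.opp = d.opp.swap from rfl, mark_swap, mark_swap]
  exact ⟨h.1, congrArg (Option.map Dir.swap) h.2⟩

theorem Matches.mark_eq {t u : Tile} {d : Dir} (h : t.Matches u d) :
    t.mark d = ⟨!(u.mark d.opp).head, (u.mark d.opp).red⟩ := by
  rw [← h.1, ← h.2]

theorem eq_of_mark_eq (e : Dir) {t u : Tile} (h : ∀ d ≠ e, t.mark d = u.mark d) : t = u := by
  revert e t u
  decide +kernel

theorem eq_of_matches (e : Dir) {t t' : Tile} {neighbour : Dir → Tile}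
    (h : ∀ d ≠ e, t.Matches (neighbour d) d) (h' : ∀ d ≠ e, t'.Matches (neighbour d) d) :
    t = t' :=
  eq_of_mark_eq e fun d hd => by rw [(h d hd).mark_eq, (h' d hd).mark_eq]

theorem red_west_eq_red_east {t : Tile} (hw : (t.mark west).head = false)
    (he : (t.mark east).head = false) : (t.mark west).red = (t.mark east).red := by
  revert t
  decide

theorem head_east_of_red_south {t : Tile} (hs : t.mark south = ⟨false, some west⟩)
    (hn : (t.mark north).head = false) : (t.mark east).head = false := by
  revert t
  decide

theorem head_eq_false_of_ne {t : Tile} {d e f : Dir} (hd : (t.mark d).head = true)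
    (he : (t.mark e).head = false) (hf : f ≠ d) : (t.mark f).head = false := by
  revert t d e f
  decide

theorem head_south_of_red_west {t : Tile} (hw : t.mark west = ⟨false, some north⟩) :
    (t.mark south).head = false := by
  revert t
  decide

theorem exists_eq_cross_of_heads {t : Tile} (hw : (t.mark west).head = true)
    (he : (t.mark east).head = true) : ∃ a b, t = cross a b := by
  revert t
  decide

end Tile

/-! ### The hierarchical tiling -/

section TileAt

variable {a b : ℤ} {m n : ℕ}

/-- The tile at the position `(a, b)`, off the two axes, of the hierarchical tiling centred at the
origin. The crosses sit where the coordinates have the same dyadic valuation. Every other tile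
lies on a grid line of the coordinate of higher valuation, and the digits of the other coordinate
tell in which half of which supertile of that level it lies. -/
def tileAt (a b : ℤ) : Tile :=
  if ord₂ a = ord₂ b then .cross (!a.testBit (ord₂ b + 1)) (!b.testBit (ord₂ b + 1))
  else if ord₂ a < ord₂ b then
    .arm ⟨false, a.testBit (ord₂ b)⟩
      (if a.testBit (ord₂ b) = a.testBit (ord₂ b + 1) then none
        else some (b.testBit (ord₂ b + 1)))
      (decide (ord₂ a + 1 = ord₂ b))
  else
    .arm ⟨true, b.testBit (ord₂ a)⟩
      (if b.testBit (ord₂ a) = b.testBit (ord₂ a + 1) then none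
        else some (a.testBit (ord₂ a + 1)))
      (decide (ord₂ b + 1 = ord₂ a))

theorem tileAt_of_eq (ha : ord₂ a = n) (hb : ord₂ b = n) :
    tileAt a b = .cross (!a.testBit (n + 1)) (!b.testBit (n + 1)) := by
  rw [tileAt, ha, hb, if_pos rfl]

theorem tileAt_of_lt (ha : ord₂ a = m) (hb : ord₂ b = n) (h : m < n) :
    tileAt a b = .arm ⟨false, a.testBit n⟩
      (if a.testBit n = a.testBit (n + 1) then none else some (b.testBit (n + 1)))
      (decide (m + 1 = n)) := by
  rw [tileAt, ha, hb, if_neg h.ne, if_pos h]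

theorem tileAt_of_gt (ha : ord₂ a = m) (hb : ord₂ b = n) (h : n < m) :
    tileAt a b = .arm ⟨true, b.testBit m⟩
      (if b.testBit m = b.testBit (m + 1) then none else some (a.testBit (m + 1)))
      (decide (n + 1 = m)) := by
  rw [tileAt, ha, hb, if_neg h.ne', if_neg h.not_gt]

theorem isCross_tileAt_iff : (tileAt a b).IsCross ↔ ord₂ a = ord₂ b := by
  rcases lt_trichotomy (ord₂ a) (ord₂ b) with h | h | h
  · simp only [tileAt_of_lt rfl rfl h, Tile.IsCross, h.ne]
  · simp only [tileAt_of_eq h rfl, Tile.IsCross, h]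
  · simp only [tileAt_of_gt rfl rfl h, h.ne', Tile.IsCross]

theorem tileAt_congr {K : ℕ} {a' b' : ℤ} (ha : ¬ 2 ^ K ∣ a) (hb : ¬ 2 ^ K ∣ b)
    (haa : 2 ^ (K + 1) ∣ a' - a) (hbb : 2 ^ (K + 1) ∣ b' - b) : tileAt a' b' = tileAt a b := by
  have ord_a := ord₂_congr ((pow_dvd_pow 2 (Nat.le_succ K)).trans haa) ha
  have ord_b := ord₂_congr ((pow_dvd_pow 2 (Nat.le_succ K)).trans hbb) hb
  have lt_a := ord₂_lt_of_not_dvd ha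
  have lt_b := ord₂_lt_of_not_dvd hb
  simp only [tileAt, ord_a, ord_b, testBit_congr haa (Nat.succ_lt_succ lt_a),
    testBit_congr haa (Nat.succ_lt_succ lt_b), testBit_congr haa (Nat.lt_succ_of_lt lt_b),
    testBit_congr hbb (Nat.succ_lt_succ lt_a), testBit_congr hbb (Nat.succ_lt_succ lt_b),
    testBit_congr hbb (Nat.lt_succ_of_lt lt_a)]

theorem tileAt_swap (a b : ℤ) : tileAt b a = (tileAt a b).swap := by
  rcases lt_trichotomy (ord₂ a) (ord₂ b) with h | h | h
  · rw [tileAt_of_lt rfl rfl h, tileAt_of_gt rfl rfl h]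
    rfl
  · rw [tileAt_of_eq h rfl, tileAt_of_eq rfl h]
    rfl
  · rw [tileAt_of_gt rfl rfl h, tileAt_of_lt rfl rfl h]
    rfl

theorem tileAt_neg (ha : a ≠ 0) (b : ℤ) : tileAt (-a) b = (tileAt a b).mirror := by
  have testBit_neg_of_lt (n : ℕ) (hn : ord₂ a < n) : (-a).testBit n = !a.testBit n :=
    testBit_neg (not_two_pow_dvd_of_ord₂_lt ha hn)
  have ord_neg := ord₂_neg a
  rcases lt_trichotomy (ord₂ a) (ord₂ b) with h | h | h
  · rw [tileAt_of_lt rfl rfl h, tileAt_of_lt ord_neg rfl h, testBit_neg_of_lt _ h,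
      testBit_neg_of_lt _ (Nat.lt_succ_of_lt h)]
    simp [Tile.mirror]
  · rw [tileAt_of_eq h rfl, tileAt_of_eq (ord_neg.trans h) rfl, testBit_neg_of_lt _ (by omega)]
    simp [Tile.mirror]
  · rw [tileAt_of_gt rfl rfl h, tileAt_of_gt ord_neg rfl h, testBit_neg_of_lt _ (by omega)]
    simp only [Tile.mirror]
    split_ifs <;> rfl

theorem tileAt_matches_east_of_odd (ha : a % 2 = 1) (ha₁ : a + 1 ≠ 0) (b : ℤ) :
    (tileAt a b).Matches (tileAt (a + 1) b) east := by
  have ord_a : ord₂ a = 0 := ord₂_of_odd ha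
  have hm : 1 ≤ ord₂ (a + 1) := (two_pow_dvd_iff_le_ord₂ ha₁ 1).1 (by omega)
  -- Adding `1` to `a` carries through exactly the digits `0, …, m`.
  generalize ord_m : ord₂ (a + 1) = m at hm
  generalize ord_n : ord₂ b = n
  have above (i : ℕ) (hi : m < i) : a.testBit i = (a + 1).testBit i :=
    (testBit_add_one (not_two_pow_dvd_of_ord₂_lt ha₁ (by omega))).symm
  have carry (i : ℕ) (hi : i ≤ m) : a.testBit i = !(a + 1).testBit i :=
    testBit_of_dvd_add_one ((two_pow_dvd_iff_le_ord₂ ha₁ i).2 (by omega))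
  have at_m : (a + 1).testBit m = true := ord_m ▸ testBit_ord₂ ha₁
  have below (i : ℕ) (hi : i < m) : (a + 1).testBit i = false :=
    testBit_of_lt_ord₂ ha₁ (by omega)
  rcases Nat.eq_zero_or_pos n with rfl | hn
  · rw [tileAt_of_eq ord_a ord_n, tileAt_of_gt ord_m ord_n hm, carry 1 hm]
    rcases eq_or_lt_of_le hm with rfl | hm
    · simp [Tile.Matches, Tile.mark, Dir.opp, at_m]
    · simp [Tile.Matches, Tile.mark, Dir.opp, below 1 hm, hm.ne]
  rw [tileAt_of_lt ord_a ord_n hn]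
  rcases lt_trichotomy m n with h | rfl | h
  · rw [tileAt_of_lt ord_m ord_n h, above n h, above (n + 1) (by omega)]
    cases (a + 1).testBit n <;> simp [Tile.Matches, Tile.mark, Dir.opp]
  · rw [tileAt_of_eq ord_m ord_n, carry m le_rfl, at_m, above (m + 1) (by omega)]
    cases (a + 1).testBit (m + 1) <;> simp [Tile.Matches, Tile.mark, Dir.opp, Dir.perp]
  · rw [tileAt_of_gt ord_m ord_n h, carry n h.le, below n h, carry (n + 1) h]
    rcases eq_or_lt_of_le (Nat.succ_le_of_lt h) with rfl | h
    · simp [at_m, Tile.Matches, Tile.mark, Dir.opp, Dir.perp]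
    · simp [below _ h, h.ne, Tile.Matches, Tile.mark, Dir.opp]

theorem tileAt_matches_east (ha : a ≠ 0) (ha₁ : a + 1 ≠ 0) (b : ℤ) :
    (tileAt a b).Matches (tileAt (a + 1) b) east := by
  rcases Int.emod_two_eq_zero_or_one a with h | h
  · have h_neg := tileAt_matches_east_of_odd (a := -(a + 1)) (by omega) (by omega) b
    rw [tileAt_neg ha₁, show -(a + 1) + 1 = -a by ring, tileAt_neg ha] at h_neg
    rw [← Tile.mirror_mirror (tileAt a b), ← Tile.mirror_mirror (tileAt (a + 1) b)]
    exact h_neg.mirror.symm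
  · exact tileAt_matches_east_of_odd h ha₁ b

theorem tileAt_matches (d : Dir) (ha : a ≠ 0) (hb : b ≠ 0) (ha₁ : a + d.vec 0 ≠ 0)
    (hb₁ : b + d.vec 1 ≠ 0) :
    (tileAt a b).Matches (tileAt (a + d.vec 0) (b + d.vec 1)) d := by
  rcases d with ⟨_ | _, _ | _⟩ <;>
    simp only [Dir.vec, Bool.false_eq_true, if_false, if_true, Pi.single_eq_same, ne_eq,
      zero_ne_one, one_ne_zero, not_false_eq_true, Pi.single_eq_of_ne, add_zero] at ha₁ hb₁ ⊢
  · have h_west := tileAt_matches_east ha₁ (by rwa [neg_add_cancel_right]) b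
    rw [neg_add_cancel_right] at h_west
    exact h_west.symm
  · exact tileAt_matches_east ha ha₁ b
  · have h_south := tileAt_matches_east hb₁ (by rwa [neg_add_cancel_right]) a
    rw [neg_add_cancel_right] at h_south
    rw [tileAt_swap b a, tileAt_swap (b + -1) a]
    exact h_south.swap.symm
  · rw [tileAt_swap b a, tileAt_swap (b + 1) a]
    exact (tileAt_matches_east hb hb₁ a).swap

end TileAt

/-! ### The subshift of the hierarchical tiling -/

/-- The hierarchical tiling as a configuration; its values on the two axes are irrelevant. -/
def hier : Config Tile 2 := fun q => tileAt (q 0) (q 1)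

theorem hier_congr {K : ℕ} {q q' : Lattice 2} (hq : ∀ i, ¬ 2 ^ K ∣ q i)
    (hqq : ∀ i, 2 ^ (K + 1) ∣ q' i - q i) : hier q' = hier q :=
  tileAt_congr (hq 0) (hq 1) (hqq 0) (hqq 1)

theorem hier_matches {q : Lattice 2} (d : Dir) (h : ∀ i, q i ≠ 0)
    (hd : ∀ i, (q + d.vec) i ≠ 0) : (hier q).Matches (hier (q + d.vec)) d :=
  tileAt_matches d (h 0) (h 1) (hd 0) (hd 1)

/-- On `box 2 N`, the configuration `x` shows the pattern of the hierarchical tiling around `u`,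
and that pattern avoids the axes. -/
def Window (x : Config Tile 2) (N : ℕ) (u : Lattice 2) : Prop :=
  ∀ p ∈ box 2 N, (∀ i, (u + p) i ≠ 0) ∧ x p = hier (u + p)

theorem Window.mono {x : Config Tile 2} {N N' : ℕ} {u : Lattice 2} (h : Window x N' u)
    (hN : N ≤ N') : Window x N u := fun p hp => h p (box_mono hN hp)

/-- The subshift `M_Rob`: the configurations whose finite patterns occur in the hierarchical
tiling off the axes. -/
def rob : Subshift Tile 2 where
  carrier := {x | ∀ N, ∃ u, Window x N u}
  isClosed := by
    refine isClosed_of_closure_subset fun x hx N => ?_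
    obtain ⟨z, hzx, hz⟩ :=
      mem_closure_iff.1 hx _ (isOpen_setOf_eqOn_box N x) fun _ _ => rfl
    obtain ⟨u, hu⟩ := hz N
    exact ⟨u, fun p hp => ⟨(hu p hp).1, (hzx hp).symm.trans (hu p hp).2⟩⟩
  shift_mem v x hx N := by
    obtain ⟨N', hv⟩ := exists_mem_box v
    obtain ⟨u, hu⟩ := hx (N + N')
    refine ⟨u - v, fun p hp => ?_⟩
    rw [sub_add_eq_add_sub, add_sub_assoc]
    exact hu (p - v) (sub_mem_box hp hv)

theorem exists_window_congr {x : Config Tile 2} (hx : x ∈ rob.carrier) (m : ℕ) [NeZero m] :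
    ∃ u : Lattice 2, ∀ N, ∃ u', (∀ i, (m : ℤ) ∣ u' i - u i) ∧ Window x N u' := by
  choose u hu using hx
  obtain ⟨r, hr⟩ := Finite.exists_infinite_fiber fun N i => (u N i : ZMod m)
  rw [Set.infinite_coe_iff] at hr
  obtain ⟨N₀, hN₀⟩ := hr.nonempty
  refine ⟨u N₀, fun N => ?_⟩
  obtain ⟨N', hN', hlt⟩ := hr.exists_gt N
  exact ⟨u N', fun i => (ZMod.intCast_eq_intCast_iff_dvd_sub _ _ m).1
    (congrFun (hN₀.trans hN'.symm) i), (hu N').mono hlt.le⟩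

theorem matches_of_mem_rob {x : Config Tile 2} (hx : x ∈ rob.carrier) (p : Lattice 2) (d : Dir) :
    (x p).Matches (x (p + d.vec)) d := by
  obtain ⟨N, hN⟩ := exists_mem_box p
  obtain ⟨N', hN'⟩ := exists_mem_box (p + d.vec)
  obtain ⟨u, hu⟩ := hx (max N N')
  obtain ⟨hp, hxp⟩ := hu p (box_mono (le_max_left _ _) hN)
  obtain ⟨hpd, hxpd⟩ := hu (p + d.vec) (box_mono (le_max_right _ _) hN')
  rw [← add_assoc] at hpd hxpd
  rw [hxp, hxpd]
  exact hier_matches d hp hpd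

theorem isCross_hier_of_odd {q : Lattice 2} (hq : ∀ i, q i % 2 = 1) : (hier q).IsCross :=
  isCross_tileAt_iff.2 ((ord₂_of_odd (hq 0)).trans (ord₂_of_odd (hq 1)).symm)

theorem emod_two_eq_of_isCross_hier {q : Lattice 2} (hq : ∀ i, q i ≠ 0)
    (h : (hier q).IsCross) : ∃ r, ∀ i, q i % 2 = r := by
  have two_dvd_iff (i : Fin 2) : 2 ∣ q i ↔ 1 ≤ ord₂ (q i) := by
    simpa only [pow_one] using two_pow_dvd_iff_le_ord₂ (hq i) 1
  have h_iff : 2 ∣ q 0 ↔ 2 ∣ q 1 := by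
    rw [two_dvd_iff, two_dvd_iff, isCross_tileAt_iff.1 h]
  exact ⟨q 0 % 2, Fin.forall_fin_two.2 ⟨rfl, by omega⟩⟩

theorem exists_cross_lattice_of_mem_rob {x : Config Tile 2} (hx : x ∈ rob.carrier) :
    ∃ k : Lattice 2, (∀ q : Lattice 2, (x (k + 2 • q)).IsCross) ∧
      ∀ p : Lattice 2, (x p).IsCross →
        (∃ q : Lattice 2, p = k + 2 • q) ∨ ∃ q : Lattice 2, p = k + 1 + 2 • q := by
  obtain ⟨u, hu⟩ := exists_window_congr hx 2
  have window (p : Lattice 2) : ∃ u' : Lattice 2, (∀ i, 2 ∣ u' i - u i) ∧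
      (∀ i, (u' + p) i ≠ 0) ∧ x p = hier (u' + p) := by
    obtain ⟨N, hN⟩ := exists_mem_box p
    obtain ⟨u', huu, hu'⟩ := hu N
    exact ⟨u', huu, hu' p hN⟩
  refine ⟨1 - u, fun q => ?_, fun p hp => ?_⟩
  · obtain ⟨u', huu, -, hxp⟩ := window (1 - u + 2 • q)
    rw [hxp]
    refine isCross_hier_of_odd fun i => ?_
    have := huu i
    simp only [two_nsmul, Pi.add_apply, Pi.sub_apply, Pi.one_apply]
    omega
  · obtain ⟨u', huu, hne, hxp⟩ := window p
    obtain ⟨r, hr⟩ := emod_two_eq_of_isCross_hier hne (hxp ▸ hp)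
    have emod_eq (i : Fin 2) : (u i + p i) % 2 = r := by
      have := huu i
      have := hr i
      rw [Pi.add_apply] at this
      omega
    rcases (hr 0 ▸ Int.emod_two_eq_zero_or_one _ : r = 0 ∨ r = 1) with rfl | rfl
    · refine .inr ⟨fun i => (p i + u i - 2) / 2, funext fun i => ?_⟩
      have := emod_eq i
      simp only [two_nsmul, Pi.add_apply, Pi.sub_apply, Pi.one_apply]
      omega
    · refine .inl ⟨fun i => (p i + u i - 1) / 2, funext fun i => ?_⟩
      have := emod_eq i
      simp only [two_nsmul, Pi.add_apply, Pi.sub_apply, Pi.one_apply]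
      omega

theorem rob_subset_robinsonShift : rob.carrier ⊆ robinsonShift :=
  fun _ hx => ⟨matches_of_mem_rob hx, exists_cross_lattice_of_mem_rob hx⟩

theorem abs_lt_two_pow_of_mem_box {N : ℕ} {p : Lattice 2} (hp : p ∈ box 2 N) (i : Fin 2) :
    |p i| < 2 ^ N :=
  (hp i).trans_lt (by exact_mod_cast Nat.lt_two_pow_self)

theorem not_two_pow_dvd_of_mem_box {N : ℕ} {q : Lattice 2} (hq : q ∈ box 2 N) {i : Fin 2}
    (hqi : q i ≠ 0) : ¬ 2 ^ N ∣ q i :=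
  fun h => hqi (Int.eq_zero_of_abs_lt_dvd h (abs_lt_two_pow_of_mem_box hq i))

theorem rob_subset_closure_orbit {x : Config Tile 2}
    (h : ∀ n : ℕ, ∃ w : Lattice 2, ∀ p : Lattice 2, (∀ i, 0 < p i ∧ p i < 2 ^ n) →
      x (w + p) = hier p) :
    rob.carrier ⊆ closure (Set.range fun v : Lattice 2 => shift v x) := by
  intro y hy
  refine mem_closure_of_forall_eqOn_box fun N => ?_
  obtain ⟨u, hu⟩ := hy N
  obtain ⟨N', hN'⟩ := exists_mem_box u
  -- Moving a pattern of size `K` by `2 ^ (K + 1)` off the axes does not change it.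
  generalize hK : N' + N = K
  obtain ⟨w, hw⟩ := h (K + 3)
  refine ⟨_, ⟨-(w + (u + fun _ => 2 ^ (K + 1))), rfl⟩, fun p hp => ?_⟩
  have hup : u + p ∈ box 2 K := hK ▸ add_mem_box hN' hp
  have h_pos (i : Fin 2) : 0 < (u + p + fun _ => 2 ^ (K + 1) : Lattice 2) i ∧
      (u + p + fun _ => 2 ^ (K + 1) : Lattice 2) i < 2 ^ (K + 3) := by
    have := abs_le.1 (hup i)
    have : (K : ℤ) < 2 ^ K := by exact_mod_cast Nat.lt_two_pow_self
    rw [Pi.add_apply, pow_succ, pow_add]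
    omega
  calc x (p - -(w + (u + fun _ => 2 ^ (K + 1))))
      = x (w + (u + p + fun _ => 2 ^ (K + 1))) := by congr 1; abel
    _ = hier (u + p + fun _ => 2 ^ (K + 1)) := hw _ h_pos
    _ = hier (u + p) := hier_congr
      (fun i => not_two_pow_dvd_of_mem_box hup ((hu p hp).1 i)) fun i => by simp
    _ = y p := (hu p hp).2.symm

/-! ### Recognizability of the hierarchy -/

theorem head_west_ne_head_east_tileAt_iff {a b : ℤ} :
    ((tileAt a b).mark west).head ≠ ((tileAt a b).mark east).head ↔ ord₂ a < ord₂ b := by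
  rcases lt_trichotomy (ord₂ a) (ord₂ b) with h | h | h
  · rw [tileAt_of_lt rfl rfl h]
    cases a.testBit (ord₂ b) <;> simp [Tile.mark, h]
  · simp [tileAt_of_eq h rfl, Tile.mark, h]
  · simp [tileAt_of_gt rfl rfl h, Tile.mark, h.le]

theorem ord₂_lt_iff_of_tileAt_eq {a b a' b' : ℤ} (h : tileAt a b = tileAt a' b') :
    ord₂ a < ord₂ b ↔ ord₂ a' < ord₂ b' := by
  rw [← head_west_ne_head_east_tileAt_iff, ← head_west_ne_head_east_tileAt_iff, h]

theorem ord₂_lt_iff_of_hier_eq {q q' : Lattice 2} (h : hier q = hier q') (i : Fin 2) :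
    ord₂ (q (i + 1)) < ord₂ (q i) ↔ ord₂ (q' (i + 1)) < ord₂ (q' i) := by
  revert i
  rw [Fin.forall_fin_two]
  refine ⟨ord₂_lt_iff_of_tileAt_eq ?_, ord₂_lt_iff_of_tileAt_eq h⟩
  rw [tileAt_swap (q 0), tileAt_swap (q' 0)]
  exact congrArg Tile.swap h

/-- The translation by `D` cannot be refuted modulo `2 ^ j`: each residue class modulo `2 ^ j` that
avoids the axes before and after the translation contains a position at which the hierarchical
tiling and its translate agree. -/
def IsAlmostPeriod (j : ℕ) (D : Lattice 2) : Prop :=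
  ∀ r : Lattice 2, (∀ i, ¬ 2 ^ j ∣ r i) → (∀ i, ¬ 2 ^ j ∣ r i + D i) →
    ∃ q : Lattice 2, (∀ i, 2 ^ j ∣ q i - r i) ∧ hier (q + D) = hier q

namespace IsAlmostPeriod

variable {j n : ℕ} {D : Lattice 2}

theorem two_dvd (h : IsAlmostPeriod 2 D) (i : Fin 2) : 2 ∣ D i := by
  by_contra hi
  -- The `i`-coordinate of `q` is odd but that of `q + D` is `2` modulo `4`, while the other
  -- coordinate of `q + D` is odd.
  obtain ⟨q, hq, hqD⟩ :=
    h (fun k => if k = i then 2 - D i else if 2 ∣ D k then 1 else 2)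
    (fun k => by split_ifs <;> omega)
    (fun k => by split_ifs with hk <;> [subst hk; skip; skip] <;> omega)
  have hi_succ : i + 1 ≠ i := fun h => one_ne_zero (add_eq_left.1 h)
  have hq_i := hq i
  have hq_succ := hq (i + 1)
  rw [if_pos rfl] at hq_i
  rw [if_neg hi_succ] at hq_succ
  have h_lt : ord₂ ((q + D) (i + 1)) < ord₂ ((q + D) i) := by
    rw [Pi.add_apply, Pi.add_apply, ord₂_of_odd (by split_ifs at hq_succ <;> omega),
      ord₂_eq_of_dvd_of_not_dvd (n := 1) (by omega) (by omega)]
    exact zero_lt_one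
  rw [ord₂_lt_iff_of_hier_eq hqD, ord₂_of_odd (a := q i) (by omega)] at h_lt
  exact Nat.not_lt_zero _ h_lt

theorem two_pow_succ_dvd (h : IsAlmostPeriod (j + 1) D) (hD : ∀ i, 2 ^ (j + 1) ∣ D i)
    (i : Fin 2) : 2 ^ (j + 2) ∣ D i := by
  have not_dvd : ¬ (2 : ℤ) ^ (j + 1) ∣ 2 ^ j := by
    rw [pow_dvd_pow_iff two_ne_zero (by decide)]
    omega
  obtain ⟨q, hq, hqD⟩ := h (fun _ => 2 ^ j) (fun _ => not_dvd) fun i hi =>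
    not_dvd ((dvd_add_left (hD i)).1 hi)
  have ord_eq (a : ℤ) (ha : 2 ^ (j + 1) ∣ a - 2 ^ j) : ord₂ a = j := by
    obtain ⟨c, hc⟩ := ha
    rw [show a = 2 ^ j * (2 * c + 1) by linear_combination hc]
    exact ord₂_two_pow_mul_of_odd j (by omega)
  have ord_q (i : Fin 2) : ord₂ (q i) = j := ord_eq _ (hq i)
  have ord_qD (i : Fin 2) : ord₂ ((q + D) i) = j := ord_eq _ <| by
    rw [Pi.add_apply, add_sub_right_comm]
    exact dvd_add (hq i) (hD i)
  have testBit_eq : ∀ i, ((q + D) i).testBit (j + 1) = (q i).testBit (j + 1) := by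
    rw [hier, hier, tileAt_of_eq (ord_qD 0) (ord_qD 1), tileAt_of_eq (ord_q 0) (ord_q 1),
      Tile.cross.injEq, Bool.not_inj_iff, Bool.not_inj_iff] at hqD
    exact Fin.forall_fin_two.2 hqD
  obtain ⟨c, hc⟩ := hD i
  have h_bit := testBit_eq i
  rw [Pi.add_apply, hc, testBit_eq_decide, testBit_eq_decide,
    Int.add_mul_ediv_left _ _ (by positivity), decide_eq_decide] at h_bit
  rw [hc, pow_succ, mul_dvd_mul_iff_left (by positivity)]
  omega

theorem two_pow_dvd (hn : 2 ≤ n) (h : ∀ j ≤ n, IsAlmostPeriod j D) (i : Fin 2) :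
    2 ^ (n + 1) ∣ D i := by
  have dvd (j : ℕ) (hj : j ≤ n) : ∀ i, 2 ^ (j + 1) ∣ D i := by
    induction j with
    | zero => simpa only [zero_add, pow_one] using (h 2 hn).two_dvd
    | succ j ih => exact (h (j + 1) hj).two_pow_succ_dvd (ih (Nat.le_of_succ_le hj))
  exact dvd n le_rfl i

end IsAlmostPeriod

/-- Modulo `2 ^ (n + 3)`, the position of the origin of `x` in the hierarchy is `u`. -/
def HasPosition (n : ℕ) (x : Config Tile 2) (u : Lattice 2) : Prop :=
  ∀ p : Lattice 2, (∀ i, ¬ 2 ^ (n + 2) ∣ (u + p) i) → x p = hier (u + p)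

theorem exists_hasPosition {x : Config Tile 2} (hx : x ∈ rob.carrier) (n : ℕ) :
    ∃ u, HasPosition n x u := by
  obtain ⟨u, hu⟩ := exists_window_congr hx (2 ^ (n + 3))
  refine ⟨u, fun p hp => ?_⟩
  obtain ⟨N, hN⟩ := exists_mem_box p
  obtain ⟨u', huu, hu'⟩ := hu N
  rw [(hu' p hN).2]
  exact hier_congr hp fun i => by simpa using huu i

theorem exists_mem_Ico_congr (c u r : Lattice 2) {m : ℤ} (hm : 0 < m) :
    ∃ p : Lattice 2, (∀ i, p i ∈ Set.Ico (c i) (c i + m)) ∧ ∀ i, m ∣ (u + p) i - r i := by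
  refine ⟨fun i => c i + (r i - u i - c i) % m, fun i => ⟨?_, ?_⟩, fun i => ?_⟩
  · exact le_add_of_nonneg_right (Int.emod_nonneg _ hm.ne')
  · exact add_lt_add_right (Int.emod_lt_of_pos _ hm) _
  · rw [dvd_sub_comm]
    have h_eq : r i - (u + fun i => c i + (r i - u i - c i) % m) i =
        r i - u i - c i - (r i - u i - c i) % m := by
      rw [Pi.add_apply]
      ring
    exact h_eq ▸ Int.dvd_self_sub_emod

namespace HasPosition

variable {m n : ℕ} {x y : Config Tile 2} {u u' c : Lattice 2}

theorem mono (h : HasPosition n x u) (hm : m ≤ n) : HasPosition m x u :=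
  fun p hp => h p fun i hd => hp i ((pow_dvd_pow 2 (by omega)).trans hd)

theorem congr (h : HasPosition n x u) (hu : ∀ i, 2 ^ (n + 3) ∣ u' i - u i) :
    HasPosition n x u' := fun p hp => by
  have hup (i : Fin 2) : 2 ^ (n + 3) ∣ (u' + p) i - (u + p) i := by
    simpa only [Pi.add_apply, add_sub_add_right_eq_sub] using hu i
  have hp' (i : Fin 2) : ¬ 2 ^ (n + 2) ∣ (u + p) i := fun hd =>
    hp i ((dvd_iff_dvd_of_dvd_sub ((pow_dvd_pow 2 (Nat.le_succ _)).trans (hup i))).2 hd)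
  rw [h p hp']
  exact (hier_congr hp' hup).symm

theorem isAlmostPeriod (hx : HasPosition n x u) (hy : HasPosition n y u')
    (hxy : ∀ p : Lattice 2, (∀ i, p i ∈ Set.Ico (c i) (c i + 2 ^ (n + 2))) → x p = y p)
    {j : ℕ} (hj : j ≤ n + 2) : IsAlmostPeriod j (u' - u) := by
  intro r hr hrD
  obtain ⟨p, hpc, hpr⟩ := exists_mem_Ico_congr c u r (m := 2 ^ j) (by positivity)
  have pow_dvd : (2 : ℤ) ^ j ∣ 2 ^ (n + 2) := pow_dvd_pow 2 hj
  have hpr' (i : Fin 2) : 2 ^ j ∣ (u' + p) i - (r i + (u' - u) i) := by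
    convert hpr i using 1
    simp only [Pi.add_apply, Pi.sub_apply]
    ring
  refine ⟨u + p, hpr, ?_⟩
  rw [show u + p + (u' - u) = u' + p by abel,
    ← hx p fun i hd => hr i ((dvd_iff_dvd_of_dvd_sub (hpr i)).1 (pow_dvd.trans hd)),
    ← hy p fun i hd => hrD i ((dvd_iff_dvd_of_dvd_sub (hpr' i)).1 (pow_dvd.trans hd))]
  have pow_le : (2 : ℤ) ^ j ≤ 2 ^ (n + 2) := pow_le_pow_right₀ (by norm_num) hj
  exact (hxy p fun i => ⟨(hpc i).1, (hpc i).2.trans_le (by gcongr)⟩).symm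

theorem unique_of_agree (hx : HasPosition n x u) (hy : HasPosition n y u')
    (hxy : ∀ p : Lattice 2, (∀ i, p i ∈ Set.Ico (c i) (c i + 2 ^ (n + 2))) → x p = y p)
    (i : Fin 2) : 2 ^ (n + 3) ∣ u' i - u i :=
  IsAlmostPeriod.two_pow_dvd (Nat.le_add_left 2 n) (fun _ hj => hx.isAlmostPeriod hy hxy hj) i

theorem unique (hx : HasPosition n x u) (hx' : HasPosition n x u') (i : Fin 2) :
    2 ^ (n + 3) ∣ u' i - u i :=
  hx.unique_of_agree hx' (c := 0) (fun _ _ => rfl) i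

end HasPosition

theorem rob_subset_closure_orbit_of_mem_rob {x : Config Tile 2} (hx : x ∈ rob.carrier) :
    rob.carrier ⊆ closure (Set.range fun v : Lattice 2 => shift v x) := by
  refine rob_subset_closure_orbit fun n => ?_
  obtain ⟨u, hu⟩ := exists_hasPosition hx n
  refine ⟨-u, fun p hp => ?_⟩
  have hlt (i : Fin 2) : p i < 2 ^ (n + 2) :=
    (hp i).2.trans_le (pow_le_pow_right₀ (by norm_num) (Nat.le_add_right n 2))
  rw [hu (-u + p), add_neg_cancel_left]
  intro i hd
  rw [add_neg_cancel_left] at hd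
  exact (Int.le_of_dvd (hp i).1 hd).not_gt (hlt i)

/-! ### Supertiles -/

section HierarchicalTiling

variable {n : ℕ} {i j a b : ℤ}

theorem not_dvd_mul_add_of_mem_Ioo {L : ℤ} (ha : a ∈ Set.Ioo 0 L) (i : ℤ) : ¬ L ∣ L * i + a :=
  fun h => (Int.le_of_dvd ha.1 ((dvd_add_right (dvd_mul_right L i)).1 h)).not_gt ha.2

theorem ord₂_two_pow_mul_add_eq_iff (j : ℤ) (hb : b ∈ Set.Ioo 0 (2 ^ (n + 1))) :
    ord₂ (2 ^ (n + 1) * j + b) = n ↔ b = 2 ^ n := by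
  have hL : (2 : ℤ) ^ (n + 1) = 2 * 2 ^ n := pow_succ' 2 n
  constructor
  · intro h
    have h_ne := ne_zero_of_not_dvd (not_dvd_mul_add_of_mem_Ioo hb j)
    obtain ⟨c, rfl⟩ : (2 : ℤ) ^ n ∣ b :=
      (dvd_add_right ((pow_dvd_pow 2 n.le_succ).mul_right j)).1
        ((two_pow_dvd_iff_le_ord₂ h_ne n).2 h.ge)
    have pos : (0 : ℤ) < 2 ^ n := by positivity
    obtain ⟨hb₀, hb₁⟩ := hb
    rw [show c = 1 by nlinarith, mul_one]
  · rintro rfl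
    rw [show (2 : ℤ) ^ (n + 1) * j + 2 ^ n = 2 ^ n * (2 * j + 1) by rw [hL]; ring]
    exact ord₂_two_pow_mul_of_odd n (by omega)

theorem tileAt_center (n : ℕ) (i j : ℤ) :
    tileAt (2 ^ (n + 1) * i + 2 ^ n) (2 ^ (n + 1) * j + 2 ^ n) =
      .cross (decide (i % 2 = 0)) (decide (j % 2 = 0)) := by
  have mem : (2 : ℤ) ^ n ∈ Set.Ioo 0 (2 ^ (n + 1)) :=
    ⟨by positivity, pow_lt_pow_right₀ one_lt_two n.lt_succ_self⟩
  have digit (i : ℤ) : (!(2 ^ (n + 1) * i + 2 ^ n).testBit (n + 1)) = decide (i % 2 = 0) := by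
    rw [testBit_two_pow_mul_add mem.1.le mem.2, ← decide_not, decide_eq_decide]
    omega
  rw [tileAt_of_eq ((ord₂_two_pow_mul_add_eq_iff i mem).2 rfl)
    ((ord₂_two_pow_mul_add_eq_iff j mem).2 rfl), digit, digit]

theorem tileAt_two_pow_mul_add_congr {i' j' : ℤ} (hi : i' % 2 = i % 2) (hj : j' % 2 = j % 2)
    (ha : a ∈ Set.Ioo 0 (2 ^ n)) (hb : b ∈ Set.Ioo 0 (2 ^ n)) :
    tileAt (2 ^ n * i' + a) (2 ^ n * j' + b) = tileAt (2 ^ n * i + a) (2 ^ n * j + b) := by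
  have period {i i' : ℤ} (a : ℤ) (h : i' % 2 = i % 2) :
      (2 : ℤ) ^ (n + 1) ∣ 2 ^ n * i' + a - (2 ^ n * i + a) := by
    rw [add_sub_add_right_eq_sub, ← mul_sub, pow_succ]
    exact mul_dvd_mul_left _ (Int.ModEq.dvd h.symm)
  exact tileAt_congr (not_dvd_mul_add_of_mem_Ioo ha i) (not_dvd_mul_add_of_mem_Ioo hb j)
    (period a hi) (period b hj)

theorem mark_west_tileAt_two_pow_mul (hi : i ≠ 0) (j : ℤ) (hb : b ∈ Set.Ioo 0 (2 ^ (n + 1))) :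
    (tileAt (2 ^ (n + 1) * i) (2 ^ (n + 1) * j + b)).mark west =
      ⟨false, if b = 2 ^ n ∧ i % 2 = 1 then some ⟨true, decide (j % 2 = 1)⟩ else none⟩ := by
  have h_ne : (2 : ℤ) ^ (n + 1) * i ≠ 0 := mul_ne_zero (by positivity) hi
  have le_ord : n + 1 ≤ ord₂ (2 ^ (n + 1) * i) :=
    (two_pow_dvd_iff_le_ord₂ h_ne _).1 (dvd_mul_right _ _)
  have ord_lt : ord₂ (2 ^ (n + 1) * j + b) < n + 1 :=
    ord₂_lt_of_not_dvd (not_dvd_mul_add_of_mem_Ioo hb j)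
  have ord_eq := ord₂_two_pow_mul_add_eq_iff j hb
  rw [tileAt_of_gt rfl rfl (ord_lt.trans_le le_ord)]
  rcases Int.emod_two_eq_zero_or_one i with hi₂ | hi₂
  · have two_add_le : n + 2 ≤ ord₂ (2 ^ (n + 1) * i) := by
      refine (two_pow_dvd_iff_le_ord₂ h_ne _).1 ?_
      rw [pow_succ _ (n + 1)]
      exact mul_dvd_mul_left _ (Int.dvd_of_emod_eq_zero hi₂)
    simp [Tile.mark, hi₂, show ¬ ord₂ (2 ^ (n + 1) * j + b) + 1 = ord₂ (2 ^ (n + 1) * i) by omega]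
  · rw [ord₂_two_pow_mul_of_odd _ hi₂, testBit_two_pow_mul_add hb.1.le hb.2]
    simp [Tile.mark, hi₂, ord_eq]

theorem mark_east_tileAt_last_column (i j : ℤ) (hb : b ∈ Set.Ioo 0 (2 ^ (n + 1))) :
    (tileAt (2 ^ (n + 1) * i + (2 ^ (n + 1) - 1)) (2 ^ (n + 1) * j + b)).mark east =
      ⟨true, if b = 2 ^ n ∧ i % 2 = 0 then some ⟨true, decide (j % 2 = 1)⟩ else none⟩ := by
  have pos : (0 : ℤ) < 2 ^ n := by positivity
  have hL : (2 : ℤ) ^ (n + 1) = 2 * 2 ^ n := pow_succ' 2 n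
  wlog hi : i ≠ -1 generalizing i
  · have shifted := this (i + 2) (by omega)
    rwa [tileAt_two_pow_mul_add_congr (i := i) (Int.add_emod_right i 2) rfl
      ⟨by omega, by omega⟩ hb, Int.add_emod_right] at shifted
  have next : (2 : ℤ) ^ (n + 1) * i + (2 ^ (n + 1) - 1) + 1 = 2 ^ (n + 1) * (i + 1) := by ring
  have next_ne : (2 : ℤ) ^ (n + 1) * (i + 1) ≠ 0 := mul_ne_zero (by positivity) (by omega)
  have odd : ((2 : ℤ) ^ (n + 1) * i + (2 ^ (n + 1) - 1)) % 2 = 1 := by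
    rw [hL, mul_assoc]
    omega
  have h_matches := tileAt_matches_east (a := 2 ^ (n + 1) * i + (2 ^ (n + 1) - 1)) (by omega)
    (by rwa [next]) (2 ^ (n + 1) * j + b)
  rw [next] at h_matches
  rw [h_matches.mark_eq, show Dir.opp east = west from rfl,
    mark_west_tileAt_two_pow_mul (by omega) j hb,
    if_congr (show (b = 2 ^ n ∧ (i + 1) % 2 = 1) ↔ (b = 2 ^ n ∧ i % 2 = 0) by omega) rfl rfl]
  rfl

theorem mark_west_tileAt_first_column (i j : ℤ) (hb : b ∈ Set.Ioo 0 (2 ^ (n + 1))) :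
    (tileAt (2 ^ (n + 1) * i + 1) (2 ^ (n + 1) * j + b)).mark west =
      ⟨true, if b = 2 ^ n ∧ i % 2 = 1 then some ⟨true, decide (j % 2 = 1)⟩ else none⟩ := by
  have odd : ((2 : ℤ) ^ (n + 1) * i + 1) % 2 = 1 := by
    rw [pow_succ', mul_assoc]
    omega
  have h_neg : tileAt (2 ^ (n + 1) * i + 1) (2 ^ (n + 1) * j + b) =
      (tileAt (2 ^ (n + 1) * (-i - 1) + (2 ^ (n + 1) - 1)) (2 ^ (n + 1) * j + b)).mirror := by
    rw [← tileAt_neg (by rw [show (2 : ℤ) ^ (n + 1) * (-i - 1) + (2 ^ (n + 1) - 1) =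
      -(2 ^ (n + 1) * i + 1) by ring]; omega)]
    congr 1
    ring
  rw [h_neg, show west = Dir.mirror east from rfl, Tile.mark_mirror,
    mark_east_tileAt_last_column _ j hb,
    if_congr (show (b = 2 ^ n ∧ (-i - 1) % 2 = 0) ↔ (b = 2 ^ n ∧ i % 2 = 1) by omega) rfl rfl]
  split_ifs <;> rfl

end HierarchicalTiling

section Supertiles

variable {n : ℕ} {X : ℤ → ℤ → Tile} {k l u v i j : ℤ}

/-- The tiling `X` obeys the matching rule and has crosses on the lattice `(k, l) + 2ℤ²`. -/
structure Legal (X : ℤ → ℤ → Tile) (k l : ℤ) : Prop where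
  rule : ∀ a b (d : Dir), (X a b).Matches (X (a + d.vec 0) (b + d.vec 1)) d
  cross : ∀ a b, (a - k) % 2 = 0 → (b - l) % 2 = 0 → (X a b).IsCross

/-- The reflection of tilings that exchanges east and west. -/
def mirrorTiling (X : ℤ → ℤ → Tile) : ℤ → ℤ → Tile := fun a b => (X (-a) b).mirror

/-- The reflection of tilings in the main diagonal. -/
def swapTiling (X : ℤ → ℤ → Tile) : ℤ → ℤ → Tile := fun a b => (X b a).swap

theorem mirrorTiling_mirrorTiling (X : ℤ → ℤ → Tile) : mirrorTiling (mirrorTiling X) = X := by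
  funext a b
  rw [mirrorTiling, mirrorTiling, neg_neg, Tile.mirror_mirror]

theorem swapTiling_swapTiling (X : ℤ → ℤ → Tile) : swapTiling (swapTiling X) = X := by
  funext a b
  rw [swapTiling, swapTiling, Tile.swap_swap]

namespace Legal

theorem mirror (h : Legal X k l) : Legal (mirrorTiling X) (-k) l where
  rule a b d := by
    have h_mirror := (h.rule (-a) b d.mirror).mirror
    rcases d with ⟨_ | _, _ | _⟩ <;>
      simpa [mirrorTiling, Dir.mirror, Dir.vec, add_comm] using h_mirror
  cross a b ha hb := (h.cross (-a) b (by omega) hb).mirror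

theorem swap (h : Legal X k l) : Legal (swapTiling X) l k where
  rule a b d := by
    have h_swap := (h.rule b a d.swap).swap
    rcases d with ⟨_ | _, _ | _⟩ <;> simpa [swapTiling, Dir.swap, Dir.vec] using h_swap
  cross a b ha hb := (h.cross b a hb ha).swap

theorem matches_east (h : Legal X k l) (a b : ℤ) : (X a b).Matches (X (a + 1) b) east := by
  simpa [Dir.vec] using h.rule a b east

end Legal

/-- A supertile of side `2 ^ (n + 1) - 1` whose lower left tile is at `(u + 1, v + 1)`. It is
oriented by the parities of `i` and `j`: its central cross points east if `i` is even and north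
if `j` is even. -/
structure Supertile (n : ℕ) (X : ℤ → ℤ → Tile) (k l u v i j : ℤ) : Prop where
  odd_left : (u - k) % 2 = 1
  odd_bottom : (v - l) % 2 = 1
  eq_tileAt : ∀ a ∈ Set.Ioo 0 (2 ^ (n + 1)), ∀ b ∈ Set.Ioo 0 (2 ^ (n + 1)),
    X (u + a) (v + b) = tileAt (2 ^ (n + 1) * i + a) (2 ^ (n + 1) * j + b)

namespace Supertile

theorem congr (h : Supertile n X k l u v i j) {i' j' : ℤ} (hi : i' % 2 = i % 2)
    (hj : j' % 2 = j % 2) : Supertile n X k l u v i' j' where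
  odd_left := h.odd_left
  odd_bottom := h.odd_bottom
  eq_tileAt a ha b hb := by
    rw [h.eq_tileAt a ha b hb, tileAt_two_pow_mul_add_congr hi hj ha hb]

theorem mirror (h : Supertile n X k l u v i j) :
    Supertile n (mirrorTiling X) (-k) l (-u - 2 ^ (n + 1)) v (-i - 1) j where
  odd_left := by
    have := h.odd_left
    rw [pow_succ]
    omega
  odd_bottom := h.odd_bottom
  eq_tileAt a ha b hb := by
    have mem : 2 ^ (n + 1) - a ∈ Set.Ioo 0 (2 ^ (n + 1)) :=
      ⟨sub_pos.2 ha.2, sub_lt_self _ ha.1⟩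
    rw [mirrorTiling, show -(-u - 2 ^ (n + 1) + a) = u + (2 ^ (n + 1) - a) by ring,
      h.eq_tileAt _ mem b hb,
      ← tileAt_neg (ne_zero_of_not_dvd (not_dvd_mul_add_of_mem_Ioo mem i))]
    congr 1
    ring

theorem swap (h : Supertile n X k l u v i j) : Supertile n (swapTiling X) l k v u j i where
  odd_left := h.odd_bottom
  odd_bottom := h.odd_left
  eq_tileAt a ha b hb := by rw [swapTiling, h.eq_tileAt b hb a ha, ← tileAt_swap]

theorem of_mirror (h : Supertile n (mirrorTiling X) (-k) l u v i j) :
    Supertile n X k l (-u - 2 ^ (n + 1)) v (-i - 1) j := by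
  simpa only [mirrorTiling_mirrorTiling, neg_neg] using h.mirror

theorem of_swap (h : Supertile n (swapTiling X) l k v u j i) : Supertile n X k l u v i j := by
  simpa only [swapTiling_swapTiling] using h.swap

theorem center (h : Supertile n X k l u v i j) :
    X (u + 2 ^ n) (v + 2 ^ n) = .cross (decide (i % 2 = 0)) (decide (j % 2 = 0)) := by
  have mem : (2 : ℤ) ^ n ∈ Set.Ioo 0 (2 ^ (n + 1)) :=
    ⟨by positivity, pow_lt_pow_right₀ one_lt_two n.lt_succ_self⟩
  rw [← tileAt_center n i j]
  exact h.eq_tileAt _ mem _ mem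

theorem emod_two_eq {i' j' : ℤ} (h : Supertile n X k l u v i j)
    (h' : Supertile n X k l u v i' j') : i % 2 = i' % 2 ∧ j % 2 = j' % 2 := by
  have center_eq := h.center.symm.trans h'.center
  simp only [Tile.cross.injEq, decide_eq_decide] at center_eq
  omega

theorem mark_right (h : Supertile n X k l u v i j) (hX : Legal X k l) {b : ℤ}
    (hb : b ∈ Set.Ioo 0 (2 ^ (n + 1))) :
    (X (u + 2 ^ (n + 1)) (v + b)).mark west =
      ⟨false, if b = 2 ^ n ∧ i % 2 = 0 then some ⟨true, decide (j % 2 = 1)⟩ else none⟩ := by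
  have h_matches := (hX.matches_east (u + (2 ^ (n + 1) - 1)) (v + b)).symm.mark_eq
  have := pow_succ (2 : ℤ) n
  have : (0 : ℤ) < 2 ^ n := by positivity
  rw [show u + (2 ^ (n + 1) - 1) + 1 = u + 2 ^ (n + 1) by ring, Dir.opp_opp,
    h.eq_tileAt (2 ^ (n + 1) - 1) ⟨by omega, by omega⟩ b hb,
    mark_east_tileAt_last_column i j hb] at h_matches
  exact h_matches

theorem mark_left (h : Supertile n X k l u v i j) (hX : Legal X k l) {b : ℤ}
    (hb : b ∈ Set.Ioo 0 (2 ^ (n + 1))) :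
    (X u (v + b)).mark east =
      ⟨false, if b = 2 ^ n ∧ i % 2 = 1 then some ⟨true, decide (j % 2 = 1)⟩ else none⟩ := by
  have h_matches := (hX.matches_east u (v + b)).mark_eq
  rw [show Dir.opp east = west from rfl,
    h.eq_tileAt 1 ⟨one_pos, one_lt_pow₀ one_lt_two n.succ_ne_zero⟩ b hb,
    mark_west_tileAt_first_column i j hb] at h_matches
  exact h_matches

theorem mark_top (h : Supertile n X k l u v i j) (hX : Legal X k l) {a : ℤ}
    (ha : a ∈ Set.Ioo 0 (2 ^ (n + 1))) :
    (X (u + a) (v + 2 ^ (n + 1))).mark south =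
      ⟨false, if a = 2 ^ n ∧ j % 2 = 0 then some ⟨false, decide (i % 2 = 1)⟩ else none⟩ := by
  rw [← swapTiling_swapTiling X, swapTiling, show south = Dir.swap west from rfl, Tile.mark_swap,
    h.swap.mark_right hX.swap ha]
  split_ifs <;> rfl

theorem mark_bottom (h : Supertile n X k l u v i j) (hX : Legal X k l) {a : ℤ}
    (ha : a ∈ Set.Ioo 0 (2 ^ (n + 1))) :
    (X (u + a) v).mark north =
      ⟨false, if a = 2 ^ n ∧ j % 2 = 1 then some ⟨false, decide (i % 2 = 1)⟩ else none⟩ := by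
  rw [← swapTiling_swapTiling X, swapTiling, show north = Dir.swap east from rfl, Tile.mark_swap,
    h.swap.mark_left hX.swap ha]
  split_ifs <;> rfl

theorem quarter (h : Supertile (n + 1) X k l u v i j) {s t : ℤ} (hs : s = 0 ∨ s = 1)
    (ht : t = 0 ∨ t = 1) :
    Supertile n X k l (u + 2 ^ (n + 1) * s) (v + 2 ^ (n + 1) * t) (2 * i + s) (2 * j + t) where
  odd_left := by
    have := h.odd_left
    rw [pow_succ', mul_assoc]
    omega
  odd_bottom := by
    have := h.odd_bottom
    rw [pow_succ', mul_assoc]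
    omega
  eq_tileAt a ha b hb := by
    have mem {s a : ℤ} (hs : s = 0 ∨ s = 1) (ha : a ∈ Set.Ioo 0 (2 ^ (n + 1))) :
        2 ^ (n + 1) * s + a ∈ Set.Ioo 0 (2 ^ (n + 2)) := by
      obtain ⟨_, _⟩ := ha
      have : (2 : ℤ) ^ (n + 2) = 2 ^ (n + 1) * 2 := pow_succ 2 (n + 1)
      rcases hs with rfl | rfl <;> constructor <;> omega
    rw [add_assoc, add_assoc, h.eq_tileAt _ (mem hs ha) _ (mem ht hb)]
    congr 1 <;> ring

theorem exists_quarter (h : Supertile (n + 1) X k l u v i j) {c d : ℤ} (hc : (c - k) % 2 = 0)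
    (hd : (d - l) % 2 = 0) (hcu : c ∈ Set.Ioo u (u + 2 ^ (n + 2)))
    (hdv : d ∈ Set.Ioo v (v + 2 ^ (n + 2))) :
    ∃ s t : ℤ,
      Supertile n X k l (u + 2 ^ (n + 1) * s) (v + 2 ^ (n + 1) * t) (2 * i + s) (2 * j + t) ∧
      c ∈ Set.Ioo (u + 2 ^ (n + 1) * s) (u + 2 ^ (n + 1) * s + 2 ^ (n + 1)) ∧
      d ∈ Set.Ioo (v + 2 ^ (n + 1) * t) (v + 2 ^ (n + 1) * t + 2 ^ (n + 1)) ∧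
      (s = 0 ∨ s = 1) ∧ (t = 0 ∨ t = 1) := by
  have half {w c : ℤ} (h_odd : (c - w) % 2 = 1) (hcw : c ∈ Set.Ioo w (w + 2 ^ (n + 2))) :
      ∃ s : ℤ, (s = 0 ∨ s = 1) ∧
        c ∈ Set.Ioo (w + 2 ^ (n + 1) * s) (w + 2 ^ (n + 1) * s + 2 ^ (n + 1)) := by
    obtain ⟨_, _⟩ := hcw
    have : (2 : ℤ) ^ (n + 2) = 2 ^ (n + 1) * 2 := pow_succ 2 (n + 1)
    have := pow_succ (2 : ℤ) n
    by_cases hlt : c < w + 2 ^ (n + 1)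
    · exact ⟨0, .inl rfl, by omega, by omega⟩
    · exact ⟨1, .inr rfl, by omega, by omega⟩
  have := h.odd_left
  have := h.odd_bottom
  obtain ⟨s, hs, hcs⟩ := half (w := u) (by omega) hcu
  obtain ⟨t, ht, hdt⟩ := half (w := v) (by omega) hdv
  exact ⟨s, t, h.quarter hs ht, hcs, hdt, hs, ht⟩

theorem corner_unique {u' v' i' j' c d : ℤ} (h : Supertile n X k l u v i j)
    (h' : Supertile n X k l u' v' i' j') (hc : (c - k) % 2 = 0) (hd : (d - l) % 2 = 0)
    (hcu : c ∈ Set.Ioo u (u + 2 ^ (n + 1))) (hdv : d ∈ Set.Ioo v (v + 2 ^ (n + 1)))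
    (hcu' : c ∈ Set.Ioo u' (u' + 2 ^ (n + 1))) (hdv' : d ∈ Set.Ioo v' (v' + 2 ^ (n + 1))) :
    u = u' ∧ v = v' := by
  induction n generalizing u v i j u' v' i' j' with
  | zero =>
    simp only [zero_add, pow_one, Set.mem_Ioo] at hcu hdv hcu' hdv'
    omega
  | succ n ih =>
    obtain ⟨s, t, hq, hcs, hdt, hs, ht⟩ := h.exists_quarter hc hd hcu hdv
    obtain ⟨s', t', hq', hcs', hdt', hs', ht'⟩ := h'.exists_quarter hc hd hcu' hdv'
    obtain ⟨eq_u, eq_v⟩ := ih hq hq' hcs hdt hcs' hdt'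
    rw [eq_u, eq_v] at hq
    obtain ⟨parity_i, parity_j⟩ := hq.emod_two_eq hq'
    obtain rfl : s = s' := by omega
    obtain rfl : t = t' := by omega
    exact ⟨add_right_cancel eq_u, add_right_cancel eq_v⟩

end Supertile

/-- A legal tiling in which every cross of the lattice `(k, l) + 2ℤ²` lies in a supertile of
level `n`. -/
structure Covered (n : ℕ) (X : ℤ → ℤ → Tile) (k l : ℤ) : Prop where
  legal : Legal X k l
  cover : ∀ c d, (c - k) % 2 = 0 → (d - l) % 2 = 0 → ∃ u v i j, Supertile n X k l u v i j ∧
    c ∈ Set.Ioo u (u + 2 ^ (n + 1)) ∧ d ∈ Set.Ioo v (v + 2 ^ (n + 1))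

namespace Covered

theorem mirror (h : Covered n X k l) : Covered n (mirrorTiling X) (-k) l where
  legal := h.legal.mirror
  cover c d hc hd := by
    obtain ⟨u, v, i, j, h_super, ⟨_, _⟩, hdv⟩ := h.cover (-c) d (by omega) hd
    exact ⟨_, _, _, _, h_super.mirror, ⟨by omega, by omega⟩, hdv⟩

theorem swap (h : Covered n X k l) : Covered n (swapTiling X) l k where
  legal := h.legal.swap
  cover c d hc hd := by
    obtain ⟨u, v, i, j, h_super, hcu, hdv⟩ := h.cover d c hd hc
    exact ⟨_, _, _, _, h_super.swap, hdv, hcu⟩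

end Covered

namespace Legal

theorem head_west_of_corridor (hX : Legal X k l) {a b c : ℤ} (hac : a ≤ c)
    (h_start : ((X a b).mark east).head = false)
    (h_side : ∀ e ∈ Set.Ioc a c, ((X e b).mark south).head = false) :
    ((X (c + 1) b).mark west).head = true := by
  have enter {c : ℤ} (h : ((X c b).mark east).head = false) :
      ((X (c + 1) b).mark west).head = true := by
    have h_matches := (hX.matches_east c b).1
    rwa [h, eq_comm, Bool.not_eq_false'] at h_matches
  induction c, hac using Int.leInduction with
  | base => exact enter h_start
  | succ c hac ih =>
    have h_west := ih fun e he => h_side e ⟨he.1, he.2.trans (by omega)⟩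
    exact enter (Tile.head_eq_false_of_ne h_west (h_side (c + 1) ⟨by omega, le_rfl⟩) (by decide))

theorem head_south_of_corridor (hX : Legal X k l) {a b c : ℤ} (hbc : b ≤ c)
    (h_start : ((X a b).mark north).head = false)
    (h_side : ∀ e ∈ Set.Ioc b c, ((X a e).mark west).head = false) :
    ((X a (c + 1)).mark south).head = true := by
  have head_swap (e : ℤ) (d : Dir) :
      ((swapTiling X e a).mark d.swap).head = ((X a e).mark d).head := by
    rw [swapTiling, Tile.mark_swap, Mark.swap]
  exact (head_swap _ south).symm.trans <| hX.swap.head_west_of_corridor hbc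
    ((head_swap b north).trans h_start) fun e he => (head_swap e west).trans (h_side e he)

end Legal

namespace Supertile

variable {i' j' : ℤ}

theorem facing_of_aligned (h : Supertile n X k l u v i j) (hX : Legal X k l) (hi : i % 2 = 0)
    (h' : Supertile n X k l (u + 2 ^ (n + 1)) v i' j') :
    Supertile n X k l (u + 2 ^ (n + 1)) v (i + 1) j := by
  have mem : (2 : ℤ) ^ n ∈ Set.Ioo 0 (2 ^ (n + 1)) :=
    ⟨by positivity, pow_lt_pow_right₀ one_lt_two n.lt_succ_self⟩
  have west_mark := h.mark_right hX mem
  have east_mark := h'.mark_left hX mem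
  have red_eq := Tile.red_west_eq_red_east (congrArg Mark.head west_mark)
    (congrArg Mark.head east_mark)
  rw [west_mark, east_mark, if_pos ⟨rfl, hi⟩] at red_eq
  by_cases hi' : i' % 2 = 1
  · simp only [hi', and_self, if_true, Option.some.injEq, Dir.mk.injEq, true_and,
      decide_eq_decide] at red_eq
    exact h'.congr (by omega) (by omega)
  · simp [hi'] at red_eq

theorem exists_right_neighbour (h : Supertile n X k l u v i j) (hX : Covered n X k l) {d : ℤ}
    (hd : (d - l) % 2 = 0) (hdv : d ∈ Set.Ioo v (v + 2 ^ (n + 1))) :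
    ∃ v' i' j', Supertile n X k l (u + 2 ^ (n + 1)) v' i' j' ∧
      d ∈ Set.Ioo v' (v' + 2 ^ (n + 1)) := by
  have := h.odd_left
  have := pow_succ (2 : ℤ) n
  have : (0 : ℤ) < 2 ^ n := by positivity
  obtain ⟨u', v', i', j', h', ⟨_, _⟩, hdv'⟩ := hX.cover (u + 2 ^ (n + 1) + 1) d (by omega) hd
  have := h'.odd_left
  obtain rfl : u' = u + 2 ^ (n + 1) := by
    by_contra h_ne
    have := (h'.corner_unique h (c := u + 2 ^ (n + 1) - 1) (by omega) hd
      ⟨by omega, by omega⟩ hdv' ⟨by omega, by omega⟩ hdv).1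
    omega
  exact ⟨v', i', j', h', hdv'⟩

theorem aligned_or_half (h : Supertile n X k l u v i j) (hX : Covered n X k l)
    (hi : i % 2 = 0) :
    Supertile n X k l (u + 2 ^ (n + 1)) v (i + 1) j ∨
      1 ≤ n ∧ ∃ i' j', Supertile n X k l (u + 2 ^ (n + 1)) (v + 2 ^ n) i' j' := by
  have := h.odd_bottom
  rcases Nat.eq_zero_or_pos n with rfl | hn
  · obtain ⟨v', i', j', h', _, _⟩ :=
      h.exists_right_neighbour hX (d := v + 1) (by omega) ⟨by omega, by omega⟩
    obtain rfl : v' = v := by omega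
    exact .inl (h.facing_of_aligned hX.legal hi h')
  obtain ⟨m, rfl⟩ := Nat.exists_eq_succ_of_ne_zero hn.ne'
  have : (0 : ℤ) < 2 ^ m := by positivity
  have : (2 : ℤ) ^ (m + 1) = 2 * 2 ^ m := pow_succ' 2 m
  have : (2 : ℤ) ^ (m + 1 + 1) = 2 * 2 ^ (m + 1) := pow_succ' 2 (m + 1)
  obtain ⟨v', i', j', h', _, _⟩ :=
    h.exists_right_neighbour hX (d := v + 2 ^ (m + 1) + 1) (by omega) ⟨by omega, by omega⟩
  by_cases half : v' = v + 2 ^ (m + 1)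
  · exact .inr ⟨hn, i', j', half ▸ h'⟩
  obtain rfl : v' = v := by
    have := h'.odd_bottom
    have west_mark := h.mark_right hX.legal (b := 2 ^ (m + 1)) ⟨by omega, by omega⟩
    have east_mark := h'.mark_left hX.legal (b := v + 2 ^ (m + 1) - v') ⟨by omega, by omega⟩
    rw [add_sub_cancel] at east_mark
    have red_eq := Tile.red_west_eq_red_east (congrArg Mark.head west_mark)
      (congrArg Mark.head east_mark)
    by_contra h_ne
    rw [west_mark, east_mark, if_pos ⟨rfl, hi⟩, if_neg (by omega)] at red_eq
    exact absurd red_eq (Option.some_ne_none _)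
  exact .inl (h.facing_of_aligned hX.legal hi h')

theorem head_west_corridor (h : Supertile n X k l u v i j) (hX : Legal X k l)
    (h' : Supertile n X k l u (v + 2 ^ (n + 1)) i' j') (hi : i % 2 = 0) (hj : j % 2 = 0) :
    ((X (u + 2 ^ (n + 1)) (v + 2 ^ (n + 1))).mark west).head = true := by
  have : (0 : ℤ) < 2 ^ n := by positivity
  have : (2 : ℤ) ^ (n + 1) = 2 * 2 ^ n := pow_succ' 2 n
  have south_mark := h.mark_top hX (a := 2 ^ n) ⟨by omega, by omega⟩
  have north_mark := h'.mark_bottom hX (a := 2 ^ n) ⟨by omega, by omega⟩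
  rw [if_pos ⟨rfl, hj⟩, decide_eq_false (by omega)] at south_mark
  have h_start := Tile.head_east_of_red_south south_mark (congrArg Mark.head north_mark)
  have h_end := hX.head_west_of_corridor (c := u + 2 ^ (n + 1) - 1) (by omega) h_start ?_
  · rwa [sub_add_cancel] at h_end
  · rintro e ⟨_, _⟩
    rw [← add_sub_cancel u e, h.mark_top hX ⟨by omega, by omega⟩]

theorem not_half_of_above (h : Supertile n X k l u v i j) (hX : Legal X k l)
    (hu : Supertile n X k l u (v + 2 ^ (n + 1)) i (j + 1)) (hi : i % 2 = 0) (hj : j % 2 = 0) :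
    ¬ Supertile n X k l (u + 2 ^ (n + 1)) (v + 2 ^ n) i' j' := by
  intro hr
  have : (0 : ℤ) < 2 ^ n := by positivity
  have : (2 : ℤ) ^ (n + 1) = 2 * 2 ^ n := pow_succ' 2 n
  have east_mark := hr.mark_left hX (b := 2 ^ n) ⟨by omega, by omega⟩
  rw [show v + 2 ^ n + 2 ^ n = v + 2 ^ (n + 1) by omega] at east_mark
  have h_start : ((X (u + 2 ^ (n + 1)) (v + 2 ^ (n + 1))).mark north).head = false :=
    Tile.head_eq_false_of_ne (h.head_west_corridor hX hu hi hj) (congrArg Mark.head east_mark)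
      (by decide)
  have h_end := hX.head_south_of_corridor (c := v + 2 ^ (n + 1) + 2 ^ n - 1) (by omega) h_start ?_
  · have west_mark := hu.mark_right hX (b := 2 ^ n) ⟨by omega, by omega⟩
    rw [if_pos ⟨rfl, hi⟩, decide_eq_true (by omega)] at west_mark
    rw [sub_add_cancel, Tile.head_south_of_red_west west_mark] at h_end
    exact Bool.false_ne_true h_end
  · rintro e ⟨_, _⟩
    rw [← add_sub_cancel (v + 2 ^ (n + 1)) e, hu.mark_right hX ⟨by omega, by omega⟩]

theorem not_half (h : Supertile n X k l u v i j) (hX : Covered n X k l) (hi : i % 2 = 0)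
    (hj : j % 2 = 0) (hn : 1 ≤ n) :
    ¬ Supertile n X k l (u + 2 ^ (n + 1)) (v + 2 ^ n) i' j' := by
  rcases h.swap.aligned_or_half hX.swap hj with hu | ⟨-, j'', i'', hu⟩
  · exact h.not_half_of_above hX.legal hu.of_swap hi hj
  · intro hr
    have := h.odd_left
    have := h.odd_bottom
    obtain ⟨m, rfl⟩ := Nat.exists_eq_succ_of_ne_zero (Nat.one_le_iff_ne_zero.1 hn)
    have : (0 : ℤ) < 2 ^ m := by positivity
    have : (2 : ℤ) ^ (m + 1) = 2 * 2 ^ m := pow_succ' 2 m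
    have : (2 : ℤ) ^ (m + 1 + 1) = 2 * 2 ^ (m + 1) := pow_succ' 2 (m + 1)
    -- Two supertiles displaced by half a period would overlap at this lattice cross.
    have := (hu.of_swap.corner_unique hr (c := u + 2 ^ (m + 1 + 1) + 1)
      (d := v + 2 ^ (m + 1 + 1) + 1) (by omega) (by omega) ⟨by omega, by omega⟩
      ⟨by omega, by omega⟩ ⟨by omega, by omega⟩ ⟨by omega, by omega⟩).1
    omega

theorem facing_right (h : Supertile n X k l u v i j) (hX : Covered n X k l) (hi : i % 2 = 0) :
    Supertile n X k l (u + 2 ^ (n + 1)) v (i + 1) j := by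
  wlog hj : j % 2 = 0 generalizing X l v j
  · have flipped := this h.swap.mirror.swap hX.swap.mirror.swap (by omega)
    convert flipped.of_swap.of_mirror.of_swap using 1 <;> ring
  rcases h.aligned_or_half hX hi with h' | ⟨hn, i', j', h'⟩
  · exact h'
  · exact (h.not_half hX hi hj hn h').elim

theorem facing_left (h : Supertile n X k l u v i j) (hX : Covered n X k l) (hi : i % 2 = 1) :
    Supertile n X k l (u - 2 ^ (n + 1)) v (i - 1) j := by
  convert (h.mirror.facing_right hX.mirror (by omega)).of_mirror using 1 <;> ring

theorem facing_above (h : Supertile n X k l u v i j) (hX : Covered n X k l) (hj : j % 2 = 0) :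
    Supertile n X k l u (v + 2 ^ (n + 1)) i (j + 1) :=
  (h.swap.facing_right hX.swap hj).of_swap

theorem exists_even_left (h : Supertile n X k l u v i j) (hX : Covered n X k l) :
    ∃ u₀ i₀, Supertile n X k l u₀ v i₀ j ∧ i₀ % 2 = 0 ∧ u ∈ Set.Icc u₀ (u₀ + 2 ^ (n + 1)) := by
  have : (0 : ℤ) < 2 ^ (n + 1) := by positivity
  rcases Int.emod_two_eq_zero_or_one i with hi | hi
  · exact ⟨u, i, h, hi, le_rfl, by omega⟩
  · exact ⟨_, _, h.facing_left hX hi, by omega, by omega, by omega⟩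

theorem exists_even (h : Supertile n X k l u v i j) (hX : Covered n X k l) :
    ∃ u₀ v₀ i₀ j₀, Supertile n X k l u₀ v₀ i₀ j₀ ∧ i₀ % 2 = 0 ∧ j₀ % 2 = 0 ∧
      u ∈ Set.Icc u₀ (u₀ + 2 ^ (n + 1)) ∧ v ∈ Set.Icc v₀ (v₀ + 2 ^ (n + 1)) := by
  obtain ⟨u₀, i₀, h₁, hi₀, hu₀⟩ := h.exists_even_left hX
  obtain ⟨v₀, j₀, h₂, hj₀, hv₀⟩ := h₁.swap.exists_even_left hX.swap
  exact ⟨u₀, v₀, i₀, j₀, h₂.of_swap, hi₀, hj₀, hu₀, hv₀⟩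

theorem exists_eq_cross_between (h : Supertile n X k l u v i j) (hX : Covered n X k l)
    (hi : i % 2 = 0) (hj : j % 2 = 0) :
    ∃ a b, X (u + 2 ^ (n + 1)) (v + 2 ^ (n + 1)) = .cross a b := by
  have hr := h.facing_right hX hi
  have head_east := hr.mirror.head_west_corridor hX.mirror.legal
    (hr.facing_above hX hj).mirror (by omega) hj
  rw [show west = Dir.mirror east from rfl, sub_add_cancel, mirrorTiling, neg_neg,
    Tile.mark_mirror] at head_east
  exact Tile.exists_eq_cross_of_heads
    (h.head_west_corridor hX.legal (h.facing_above hX hj) hi hj) head_east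

end Supertile

/-- The tiling `X` obeys the matching rule inside the open square `(0, M)²`. -/
def MatchesOnSquare (M : ℤ) (X : ℤ → ℤ → Tile) : Prop :=
  ∀ a ∈ Set.Ioo 0 M, ∀ b ∈ Set.Ioo 0 M, ∀ d : Dir, a + d.vec 0 ∈ Set.Ioo 0 M →
    b + d.vec 1 ∈ Set.Ioo 0 M → (X a b).Matches (X (a + d.vec 0) (b + d.vec 1)) d

theorem matchesOnSquare_tileAt (n : ℕ) (i j : ℤ) :
    MatchesOnSquare (2 ^ n) fun a b => tileAt (2 ^ n * i + a) (2 ^ n * j + b) := by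
  intro a ha b hb d ha' hb'
  have ne_zero (i : ℤ) {a : ℤ} (ha : a ∈ Set.Ioo 0 (2 ^ n)) : 2 ^ n * i + a ≠ 0 :=
    ne_zero_of_not_dvd (not_dvd_mul_add_of_mem_Ioo ha i)
  have h_matches := tileAt_matches d (ne_zero i ha) (ne_zero j hb)
    (by rw [add_assoc]; exact ne_zero i ha') (by rw [add_assoc]; exact ne_zero j hb')
  rwa [add_assoc, add_assoc] at h_matches

theorem Legal.matchesOnSquare (h : Legal X k l) (M u v : ℤ) :
    MatchesOnSquare M fun a b => X (u + a) (v + b) := by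
  intro a _ b _ d _ _
  have h_matches := h.rule (u + a) (v + b) d
  rwa [add_assoc, add_assoc] at h_matches

namespace MatchesOnSquare

variable {L M a b : ℤ} {Y : ℤ → ℤ → Tile}

theorem swap (h : MatchesOnSquare M X) : MatchesOnSquare M (swapTiling X) := by
  intro a ha b hb d ha' hb'
  rcases d with ⟨_ | _, _ | _⟩
  exacts [(h b hb a ha south hb' ha').swap, (h b hb a ha north hb' ha').swap,
    (h b hb a ha west hb' ha').swap, (h b hb a ha east hb' ha').swap]

theorem eq_of_neighbours (hX : MatchesOnSquare M X) (hY : MatchesOnSquare M Y) (e : Dir)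
    (ha : a ∈ Set.Ioo 0 M) (hb : b ∈ Set.Ioo 0 M)
    (h : ∀ d ≠ e, a + d.vec 0 ∈ Set.Ioo 0 M ∧ b + d.vec 1 ∈ Set.Ioo 0 M ∧
      X (a + d.vec 0) (b + d.vec 1) = Y (a + d.vec 0) (b + d.vec 1)) : X a b = Y a b := by
  refine Tile.eq_of_matches e (neighbour := fun d => Y (a + d.vec 0) (b + d.vec 1))
    (fun d hd => ?_) fun d hd => hY a ha b hb d (h d hd).1 (h d hd).2.1
  rw [← (h d hd).2.2]
  exact hX a ha b hb d (h d hd).1 (h d hd).2.1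

theorem eq_on_middle_column (hX : MatchesOnSquare (2 * L) X) (hY : MatchesOnSquare (2 * L) Y)
    (h_off : ∀ a ∈ Set.Ioo 0 (2 * L), ∀ b ∈ Set.Ioo 0 (2 * L), a ≠ L → b ≠ L → X a b = Y a b)
    (h_mid : X L L = Y L L) (hL : 1 < L) (hb : b ∈ Set.Ioo 0 (2 * L)) : X L b = Y L b := by
  have memL : L ∈ Set.Ioo 0 (2 * L) := ⟨by omega, by omega⟩
  induction h_dist : (b - L).natAbs generalizing b with
  | zero =>
    obtain rfl : b = L := by omega
    exact h_mid
  | succ t ih =>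
    have beside (p : Bool) : L + Dir.vec ⟨false, p⟩ 0 ∈ Set.Ioo 0 (2 * L) ∧
        b + Dir.vec ⟨false, p⟩ 1 ∈ Set.Ioo 0 (2 * L) ∧ X (L + Dir.vec ⟨false, p⟩ 0)
          (b + Dir.vec ⟨false, p⟩ 1) = Y (L + Dir.vec ⟨false, p⟩ 0) (b + Dir.vec ⟨false, p⟩ 1) := by
      have h_unit : Dir.vec ⟨false, p⟩ 0 = 1 ∨ Dir.vec ⟨false, p⟩ 0 = -1 := by cases p <;> decide
      have mem : L + Dir.vec ⟨false, p⟩ 0 ∈ Set.Ioo 0 (2 * L) := ⟨by omega, by omega⟩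
      rw [show Dir.vec ⟨false, p⟩ 1 = 0 from rfl, add_zero]
      exact ⟨mem, hb, h_off _ mem b hb (by omega) (by omega)⟩
    obtain ⟨_, _⟩ := id hb
    rcases lt_or_ge b L with hbL | hbL
    · have mem : b + 1 ∈ Set.Ioo 0 (2 * L) := ⟨by omega, by omega⟩
      refine eq_of_neighbours hX hY south memL hb fun d hd => ?_
      rcases d with ⟨_ | _, p⟩
      · exact beside p
      · obtain rfl : p = true := by simpa using hd
        rw [show Dir.vec north 0 = 0 from rfl, show Dir.vec north 1 = 1 from rfl, add_zero]
        exact ⟨memL, mem, ih mem (by omega)⟩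
    · have mem : b + -1 ∈ Set.Ioo 0 (2 * L) := ⟨by omega, by omega⟩
      refine eq_of_neighbours hX hY north memL hb fun d hd => ?_
      rcases d with ⟨_ | _, p⟩
      · exact beside p
      · obtain rfl : p = false := by simpa using hd
        rw [show Dir.vec south 0 = 0 from rfl, show Dir.vec south 1 = -1 from rfl, add_zero]
        exact ⟨memL, mem, ih mem (by omega)⟩

theorem eq_of_eq_off_middle (hX : MatchesOnSquare (2 * L) X) (hY : MatchesOnSquare (2 * L) Y)
    (h_off : ∀ a ∈ Set.Ioo 0 (2 * L), ∀ b ∈ Set.Ioo 0 (2 * L), a ≠ L → b ≠ L → X a b = Y a b)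
    (h_mid : X L L = Y L L) (hL : 1 < L) (ha : a ∈ Set.Ioo 0 (2 * L))
    (hb : b ∈ Set.Ioo 0 (2 * L)) : X a b = Y a b := by
  by_cases haL : a = L
  · rw [haL]
    exact hX.eq_on_middle_column hY h_off h_mid hL hb
  by_cases hbL : b = L
  · have transposed : swapTiling X L a = swapTiling Y L a :=
      hX.swap.eq_on_middle_column hY.swap
        (fun a ha b hb haL hbL => congrArg Tile.swap (h_off b hb a ha hbL haL))
        (congrArg Tile.swap h_mid) hL ha
    rw [hbL]
    exact Function.LeftInverse.injective Tile.swap_swap transposed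
  · exact h_off a ha b hb haL hbL

end MatchesOnSquare

theorem exists_eq_cross_decide {t : Tile} (ht : t.IsCross) :
    ∃ i j : ℤ, t = .cross (decide (i % 2 = 0)) (decide (j % 2 = 0)) := by
  rcases t with ⟨a, b⟩ | _
  · exact ⟨if a then 0 else 1, if b then 0 else 1, by cases a <;> cases b <;> rfl⟩
  · exact ht.elim

namespace Supertile

theorem of_quarters (hX : Legal X k l)
    (h_quarter : ∀ s t : ℤ, (s = 0 ∨ s = 1) → (t = 0 ∨ t = 1) →
      Supertile n X k l (u + 2 ^ (n + 1) * s) (v + 2 ^ (n + 1) * t) (2 * i + s) (2 * j + t))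
    (h_mid : X (u + 2 ^ (n + 1)) (v + 2 ^ (n + 1)) =
      .cross (decide (i % 2 = 0)) (decide (j % 2 = 0))) :
    Supertile (n + 1) X k l u v i j := by
  have corner := h_quarter 0 0 (.inl rfl) (.inl rfl)
  rw [mul_zero, add_zero, add_zero] at corner
  refine ⟨corner.odd_left, corner.odd_bottom, fun a ha b hb => ?_⟩
  have hL : (2 : ℤ) ^ (n + 1 + 1) = 2 * 2 ^ (n + 1) := pow_succ' 2 (n + 1)
  have half {a : ℤ} (ha : a ∈ Set.Ioo 0 (2 * 2 ^ (n + 1))) (haL : a ≠ 2 ^ (n + 1)) :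
      ∃ s : ℤ, (s = 0 ∨ s = 1) ∧ ∃ r ∈ Set.Ioo (0 : ℤ) (2 ^ (n + 1)), a = 2 ^ (n + 1) * s + r := by
    obtain ⟨_, _⟩ := ha
    rcases lt_or_gt_of_ne haL with h | h
    · exact ⟨0, .inl rfl, a, ⟨by omega, h⟩, by ring⟩
    · exact ⟨1, .inr rfl, a - 2 ^ (n + 1), ⟨by omega, by omega⟩, by ring⟩
  have matches_hier := matchesOnSquare_tileAt (n + 1 + 1) i j
  rw [hL] at ha hb matches_hier
  rw [hL]
  refine (hX.matchesOnSquare _ u v).eq_of_eq_off_middle matches_hier ?_ ?_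
    (one_lt_pow₀ one_lt_two n.succ_ne_zero) ha hb
  · intro a ha b hb haL hbL
    obtain ⟨s, hs, r, hr, rfl⟩ := half ha haL
    obtain ⟨t, ht, q, hq, rfl⟩ := half hb hbL
    rw [← add_assoc, ← add_assoc, (h_quarter s t hs ht).eq_tileAt r hr q hq]
    congr 1 <;> ring
  · rw [← hL, tileAt_center, h_mid]

theorem exists_next (h : Supertile n X k l u v i j) (hX : Covered n X k l) (hi : i % 2 = 0)
    (hj : j % 2 = 0) : ∃ I J, Supertile (n + 1) X k l u v I J := by
  obtain ⟨a, b, h_cross⟩ := h.exists_eq_cross_between hX hi hj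
  obtain ⟨I, J, h_mid⟩ := exists_eq_cross_decide (t := .cross a b) trivial
  refine ⟨I, J, of_quarters hX.legal (fun s t hs ht => ?_) (h_cross.trans h_mid)⟩
  have h_facing :
      Supertile n X k l (u + 2 ^ (n + 1) * s) (v + 2 ^ (n + 1) * t) (i + s) (j + t) := by
    rcases hs with rfl | rfl <;> rcases ht with rfl | rfl <;>
      simp only [mul_zero, mul_one, add_zero]
    · exact h
    · exact h.facing_above hX hj
    · exact h.facing_right hX hi
    · exact (h.facing_right hX hi).facing_above hX hj
  exact h_facing.congr (by omega) (by omega)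

theorem exists_of_cross {c d : ℤ} (hX : Legal X k l) (hc : (c - k) % 2 = 0)
    (hd : (d - l) % 2 = 0) : ∃ i j, Supertile 0 X k l (c - 1) (d - 1) i j := by
  obtain ⟨i, j, h_cross⟩ := exists_eq_cross_decide (hX.cross c d hc hd)
  refine ⟨i, j, by omega, by omega, ?_⟩
  rintro a ⟨_, _⟩ b ⟨_, _⟩
  obtain rfl : a = 2 ^ 0 := by omega
  obtain rfl : b = 2 ^ 0 := by omega
  rw [tileAt_center, pow_zero, sub_add_cancel, sub_add_cancel, h_cross]

end Supertile

theorem Legal.covered (hX : Legal X k l) (n : ℕ) : Covered n X k l := by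
  refine ⟨hX, ?_⟩
  induction n with
  | zero =>
    intro c d hc hd
    obtain ⟨i, j, h_super⟩ := Supertile.exists_of_cross hX hc hd
    exact ⟨c - 1, d - 1, i, j, h_super, ⟨by omega, by omega⟩, ⟨by omega, by omega⟩⟩
  | succ n ih =>
    intro c d hc hd
    obtain ⟨u, v, i, j, h_super, ⟨_, _⟩, _, _⟩ := ih c d hc hd
    obtain ⟨u₀, v₀, i₀, j₀, h_even, hi₀, hj₀, ⟨_, _⟩, _, _⟩ := h_super.exists_even ⟨hX, ih⟩
    obtain ⟨I, J, h_next⟩ := h_even.exists_next ⟨hX, ih⟩ hi₀ hj₀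
    have : (2 : ℤ) ^ (n + 1 + 1) = 2 * 2 ^ (n + 1) := pow_succ' 2 (n + 1)
    exact ⟨u₀, v₀, I, J, h_next, ⟨by omega, by omega⟩, ⟨by omega, by omega⟩⟩

end Supertiles

theorem exists_legal_of_mem_robinsonShift {x : Config Tile 2} (hx : x ∈ robinsonShift) :
    ∃ k l, Legal (fun a b => x ![a, b]) k l := by
  obtain ⟨h_rule, k, h_cross, -⟩ := hx
  refine ⟨k 0, k 1, fun a b d => ?_, fun a b ha hb => ?_⟩
  · convert h_rule ![a, b] d using 2
    ext i
    fin_cases i <;> rfl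
  · convert h_cross ![(a - k 0) / 2, (b - k 1) / 2]
    ext i
    fin_cases i <;> simp <;> omega

theorem rob_subset_closure_orbit_of_mem_robinsonShift {x : Config Tile 2}
    (hx : x ∈ robinsonShift) :
    rob.carrier ⊆ closure (Set.range fun v : Lattice 2 => shift v x) := by
  obtain ⟨k, l, h_legal⟩ := exists_legal_of_mem_robinsonShift hx
  refine rob_subset_closure_orbit fun n => ?_
  obtain ⟨u, v, i, j, h_super, -⟩ := (h_legal.covered (n + 1)).cover k l (by simp) (by simp)
  refine ⟨![u, v], fun p hp => ?_⟩
  have : (2 : ℤ) ^ (n + 1 + 1) = 4 * 2 ^ n := by ring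
  obtain ⟨hp₀, hp₀'⟩ := hp 0
  obtain ⟨hp₁, hp₁'⟩ := hp 1
  have at_p := h_super.eq_tileAt (p 0) ⟨hp₀, by omega⟩ (p 1) ⟨hp₁, by omega⟩
  rw [show ![u, v] + p = ![u + p 0, v + p 1] by ext i; fin_cases i <;> rfl, at_p]
  have not_dvd {a : ℤ} (h₀ : 0 < a) (h₁ : a < 2 ^ n) : ¬ (2 : ℤ) ^ n ∣ a :=
    fun h => (Int.le_of_dvd h₀ h).not_gt h₁
  refine tileAt_congr (not_dvd hp₀ hp₀') (not_dvd hp₁ hp₁') ?_ ?_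
  · exact ⟨2 * i, by ring⟩
  · exact ⟨2 * j, by ring⟩

/-! ### Points with a singular row, and minimality -/

theorem testBit_of_abs_lt {n : ℕ} {a : ℤ} (h : |a| < 2 ^ n) : a.testBit n = decide (a < 0) := by
  rcases lt_or_ge a 0 with ha | ha
  · have h_eq : 2 ^ n * -1 + (2 ^ n + a) = a := by ring
    rw [abs_of_neg ha] at h
    rw [← h_eq, testBit_two_pow_mul_add (by omega) (by omega), h_eq, decide_eq_true ha]
    rfl
  · rw [abs_of_nonneg ha] at h
    have h_bit := testBit_two_pow_mul_add (c := 0) ha h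
    rw [mul_zero, zero_add] at h_bit
    rw [h_bit, decide_eq_false ha.not_gt]
    rfl

theorem tileAt_of_abs_lt {m n : ℕ} {a b : ℤ} (ha : a ≠ 0) (ham : |a| < 2 ^ m) (hmn : m < n)
    (hb : ord₂ b = n) : tileAt a b = .arm ⟨false, decide (a < 0)⟩ none false := by
  have hlt : ord₂ a < m := ord₂_lt_of_not_dvd fun hd => ha (Int.eq_zero_of_abs_lt_dvd hd ham)
  have testBit_eq (k : ℕ) (hk : m ≤ k) : a.testBit k = decide (a < 0) :=
    testBit_of_abs_lt (ham.trans_le (pow_le_pow_right₀ one_le_two hk))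
  rw [tileAt_of_lt rfl hb (by omega), testBit_eq n hmn.le, testBit_eq (n + 1) (by omega),
    if_pos rfl, decide_eq_false (show ord₂ a + 1 ≠ n by omega)]

/-- The limit of supertiles with an infinite horizontal arm in the row `0`, which points to the
right if `e` holds and to the left otherwise, and with infinite vertical arms in the column `0`
that point towards that row. -/
def rowPoint (e : Bool) : Config Tile 2 := fun p =>
  if p 1 = 0 then .arm ⟨false, e⟩ none false
  else if p 0 = 0 then .arm ⟨true, decide (p 1 < 0)⟩ none false
  else hier p

theorem tileAt_add_eq_rowPoint {N : ℕ} {s : ℤ} (hs : |s| = 2 ^ (N + 2)) {p : Lattice 2}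
    (hp : p ∈ box 2 N) :
    tileAt (s + p 0) (2 ^ (2 * (N + 2)) + p 1) = rowPoint (decide (s < 0)) p := by
  have dvd_s (n : ℕ) : 2 ^ n ∣ s ↔ n ≤ N + 2 := by
    rw [← dvd_abs, hs, pow_dvd_pow_iff two_ne_zero (by decide)]
  have ord_s : ord₂ s = N + 2 :=
    ord₂_eq_of_dvd_of_not_dvd ((dvd_s _).2 le_rfl) fun h => by simpa using (dvd_s _).1 h
  have dvd_pow (n : ℕ) (hn : n ≤ 2 * (N + 2)) : (2 : ℤ) ^ n ∣ 2 ^ (2 * (N + 2)) := pow_dvd_pow 2 hn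
  have lt₀ := abs_lt.1 (abs_lt_two_pow_of_mem_box hp 0)
  unfold rowPoint
  split_ifs with hp₁ hp₀
  · have ord_pow : ord₂ (2 ^ (2 * (N + 2))) = 2 * (N + 2) := by
      simpa only [mul_one] using ord₂_two_pow_mul_of_odd (2 * (N + 2)) (c := 1) rfl
    have h_neg : s + p 0 < 0 ↔ s < 0 := by grind
    have h_abs : |s + p 0| < 2 ^ (N + 3) := by grind
    rw [hp₁, add_zero, tileAt_of_abs_lt (by grind) h_abs (by omega) ord_pow,
      decide_eq_decide.2 h_neg]
  · have lt₁ := abs_lt_two_pow_of_mem_box hp 1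
    rw [hp₀, add_zero, tileAt_congr (K := N + 3) (a := s) (b := p 1)
        (by rw [dvd_s]; omega) (fun hd => hp₁ (Int.eq_zero_of_abs_lt_dvd hd (by grind)))
        (by simp) (by simpa using dvd_pow _ (by omega)),
      tileAt_swap, tileAt_of_abs_lt hp₁ lt₁ (by omega) ord_s]
    rfl
  · exact tileAt_congr (K := N) (not_two_pow_dvd_of_mem_box hp hp₀)
      (not_two_pow_dvd_of_mem_box hp hp₁) (by simpa using (dvd_s (N + 1)).2 (by omega))
      (by simpa using dvd_pow (N + 1) (by omega))

theorem rowPoint_mem (e : Bool) : rowPoint e ∈ rob.carrier := by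
  intro N
  obtain ⟨s, hs, rfl⟩ : ∃ s : ℤ, |s| = 2 ^ (N + 2) ∧ decide (s < 0) = e := by
    cases e
    exacts [⟨2 ^ (N + 2), by simp, by simp⟩, ⟨-2 ^ (N + 2), by simp, by simp⟩]
  refine ⟨![s, 2 ^ (2 * (N + 2))], fun p hp => ⟨?_, (tileAt_add_eq_rowPoint hs hp).symm⟩⟩
  have lt_pow (n : ℕ) (hn : N ≤ n) (i : Fin 2) : |p i| < 2 ^ n :=
    (abs_lt_two_pow_of_mem_box hp i).trans_le (pow_le_pow_right₀ one_le_two hn)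
  refine Fin.forall_fin_two.2 ⟨fun h => ?_, fun h => ?_⟩
  · have := lt_pow (N + 2) (by omega) 0
    rw [eq_neg_of_add_eq_zero_right h, abs_neg] at this
    exact this.ne hs
  · have := lt_pow (2 * (N + 2)) (by omega) 1
    rw [eq_neg_of_add_eq_zero_right h, abs_neg] at this
    exact (this.trans_le (le_abs_self _)).false

theorem rob_isMinimal : rob.IsMinimal :=
  ⟨⟨_, rowPoint_mem true⟩, fun _ hx => rob_subset_closure_orbit_of_mem_rob hx⟩

theorem eq_rob_of_isMinimal {M : Subshift Tile 2} (hM : M.IsMinimal)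
    (hsub : M.carrier ⊆ robinsonShift) : M = rob :=
  Subshift.eq_of_isMinimal_of_subset_closure_orbit hM hsub ⟨_, rowPoint_mem true⟩
    fun _ => rob_subset_closure_orbit_of_mem_robinsonShift

/-! ### Reflections -/

/-- A reflection of the hierarchical tiling: the linear involution `B` of the plane acts on it
through the involution `φ` of the tiles. -/
structure IsReflection (B : Matrix (Fin 2) (Fin 2) ℤ) (φ : Tile → Tile) : Prop where
  mul_self : B * B = 1
  involutive : Function.Involutive φ
  mulVec_mem_box {N : ℕ} {p : Lattice 2} : p ∈ box 2 N → B *ᵥ p ∈ box 2 N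
  mulVec_ne_zero {q : Lattice 2} : (∀ i, q i ≠ 0) → ∀ i, (B *ᵥ q) i ≠ 0
  hier_mulVec {q : Lattice 2} : (∀ i, q i ≠ 0) → hier (B *ᵥ q) = φ (hier q)

/-- The image of a configuration under a reflection. -/
def reflect (B : Matrix (Fin 2) (Fin 2) ℤ) (φ : Tile → Tile) (x : Config Tile 2) :
    Config Tile 2 := fun p => φ (x (B *ᵥ p))

theorem reflMatrix_mulVec (q : Lattice 2) : reflMatrix *ᵥ q = ![-q 0, q 1] := by
  ext i
  fin_cases i <;> simp [reflMatrix, mulVec, dotProduct]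

theorem isReflection_mirror : IsReflection reflMatrix Tile.mirror where
  mul_self := by decide
  involutive := Tile.mirror_mirror
  mulVec_mem_box hp := by
    rw [reflMatrix_mulVec]
    exact Fin.forall_fin_two.2 ⟨(abs_neg _).trans_le (hp 0), hp 1⟩
  mulVec_ne_zero hq := by
    rw [reflMatrix_mulVec]
    exact Fin.forall_fin_two.2 ⟨neg_ne_zero.2 (hq 0), hq 1⟩
  hier_mulVec hq := by
    rw [reflMatrix_mulVec]
    exact tileAt_neg (hq 0) _

theorem swapMatrix_mulVec (q : Lattice 2) : !![0, 1; 1, 0] *ᵥ q = ![q 1, q 0] := by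
  ext i
  fin_cases i <;> simp [mulVec, dotProduct]

theorem isReflection_swap : IsReflection !![0, 1; 1, 0] Tile.swap where
  mul_self := by decide
  involutive := Tile.swap_swap
  mulVec_mem_box hp := by
    rw [swapMatrix_mulVec]
    exact Fin.forall_fin_two.2 ⟨hp 1, hp 0⟩
  mulVec_ne_zero hq := by
    rw [swapMatrix_mulVec]
    exact Fin.forall_fin_two.2 ⟨hq 1, hq 0⟩
  hier_mulVec _ := by
    rw [swapMatrix_mulVec]
    exact tileAt_swap _ _

/-- The configuration shows the hierarchical tiling off the two axes; no constraint is put on its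
tiles on the axes. -/
def IsCentered (x : Config Tile 2) : Prop := ∀ p : Lattice 2, (∀ i, p i ≠ 0) → x p = hier p

theorem isCentered_rowPoint (e : Bool) : IsCentered (rowPoint e) := fun _ hp =>
  (if_neg (hp 1)).trans (if_neg (hp 0))

theorem rowPoint_true_ne_false : rowPoint true ≠ rowPoint false := fun h => by
  simpa [rowPoint] using congrFun h 0

theorem rowPoint_eq_of_ne_zero (e e' : Bool) {p : Lattice 2} (hp : p 1 ≠ 0) :
    rowPoint e p = rowPoint e' p := by
  simp only [rowPoint, if_neg hp]

namespace IsReflection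

variable {B : Matrix (Fin 2) (Fin 2) ℤ} {φ : Tile → Tile}

theorem mulVec_mulVec_self (h : IsReflection B φ) (p : Lattice 2) : B *ᵥ B *ᵥ p = p := by
  rw [mulVec_mulVec, h.mul_self, one_mulVec]

theorem reflect_reflect (h : IsReflection B φ) (x : Config Tile 2) :
    reflect B φ (reflect B φ x) = x := by
  ext p
  simp only [reflect, h.mulVec_mulVec_self, h.involutive _]

theorem reflect_mem (h : IsReflection B φ) {x : Config Tile 2} (hx : x ∈ rob.carrier) :
    reflect B φ x ∈ rob.carrier := fun N => by
  obtain ⟨u, hu⟩ := hx N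
  refine ⟨B *ᵥ u, fun p hp => ?_⟩
  obtain ⟨hne, hxp⟩ := hu (B *ᵥ p) (h.mulVec_mem_box hp)
  have h_eq : B *ᵥ u + p = B *ᵥ (u + B *ᵥ p) := by rw [mulVec_add, h.mulVec_mulVec_self]
  rw [h_eq, h.hier_mulVec hne, ← hxp]
  exact ⟨h.mulVec_ne_zero hne, rfl⟩

theorem isCentered_reflect (h : IsReflection B φ) {x : Config Tile 2} (hx : IsCentered x) :
    IsCentered (reflect B φ x) := fun p hp => by
  rw [reflect, hx _ (h.mulVec_ne_zero hp), h.hier_mulVec hp, h.involutive]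

theorem continuous_reflect (h : IsReflection B φ) : Continuous fun x : rob.carrier =>
    (⟨reflect B φ x.1, h.reflect_mem x.2⟩ : rob.carrier) :=
  Continuous.subtype_mk (continuous_pi fun _ =>
    continuous_of_discreteTopology.comp ((continuous_apply _).comp continuous_subtype_val)) _

/-- A reflection of the hierarchical tiling as a homeomorphism of `M_Rob`. -/
def homeo (h : IsReflection B φ) : rob.carrier ≃ₜ rob.carrier where
  toFun x := ⟨reflect B φ x.1, h.reflect_mem x.2⟩
  invFun x := ⟨reflect B φ x.1, h.reflect_mem x.2⟩
  left_inv x := Subtype.ext (h.reflect_reflect x.1)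
  right_inv x := Subtype.ext (h.reflect_reflect x.1)
  continuous_toFun := h.continuous_reflect
  continuous_invFun := h.continuous_reflect

theorem reflect_shift (h : IsReflection B φ) (v : Lattice 2) (x : Config Tile 2) :
    reflect B φ (shift v x) = shift (B *ᵥ v) (reflect B φ x) := by
  ext p
  simp only [reflect, shift, mulVec_sub, h.mulVec_mulVec_self]

end IsReflection

/-! ### Singular lines -/

/-- The line of lattice points with `i`-th coordinate `c` lies in no finite level of the
hierarchy of `x`. -/
def IsSingularLine (i : Fin 2) (x : Config Tile 2) (c : ℤ) : Prop :=
  ∀ n u, HasPosition n x u → 2 ^ (n + 2) ∣ u i + c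

/-- Every position of `x` in the hierarchy of supertiles is one of `y`. -/
def SamePosition (x y : Config Tile 2) : Prop :=
  ∀ n u, HasPosition n x u → HasPosition n y u

theorem eq_of_forall_two_pow_dvd_sub {a b : ℤ} (h : ∀ n : ℕ, 2 ^ n ∣ a - b) : a = b :=
  sub_eq_zero.1 <| Int.eq_zero_of_abs_lt_dvd (h (a - b).natAbs) <| by
    rw [Int.abs_eq_natAbs]
    exact_mod_cast Nat.lt_two_pow_self

theorem IsSingularLine.unique {i : Fin 2} {x : Config Tile 2} (hx : x ∈ rob.carrier) {c c' : ℤ}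
    (h : IsSingularLine i x c) (h' : IsSingularLine i x c') : c = c' := by
  refine eq_of_forall_two_pow_dvd_sub fun n => ?_
  obtain ⟨u, hu⟩ := exists_hasPosition hx n
  have hd := dvd_sub (h n u hu) (h' n u hu)
  rw [add_sub_add_left_eq_sub] at hd
  exact (pow_dvd_pow 2 (Nat.le_add_right n 2)).trans hd

theorem exists_isSingularLine_of_ne {x y : Config Tile 2} (hx : x ∈ rob.carrier)
    (hxy : SamePosition x y) {q : Lattice 2} (hq : x q ≠ y q) :
    ∃ i, IsSingularLine i x (q i) := by
  by_contra! h
  unfold IsSingularLine at h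
  push Not at h
  choose n u hu hd using h
  obtain ⟨w, hw⟩ := exists_hasPosition hx (Finset.univ.sup n)
  have not_dvd (i : Fin 2) : ¬ 2 ^ (Finset.univ.sup n + 2) ∣ (w + q) i := fun hdw => hd i <| by
    have hn : n i ≤ Finset.univ.sup n := Finset.le_sup (Finset.mem_univ i)
    have h_sub : 2 ^ (n i + 2) ∣ (w + q) i - (u i i + q i) := by
      rw [Pi.add_apply, add_sub_add_right_eq_sub]
      exact (pow_dvd_pow 2 (Nat.le_succ _)).trans ((hu i).unique (hw.mono hn) i)
    exact (dvd_iff_dvd_of_dvd_sub h_sub).1 ((pow_dvd_pow 2 (by omega)).trans hdw)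
  exact hq ((hw q not_dvd).trans (hxy _ _ hw q not_dvd).symm)

namespace Dir

/-- The coordinate that changes along a direction. -/
def axis (d : Dir) : Fin 2 := if d.vert then 1 else 0

/-- The coordinate that is constant along a direction. -/
def coaxis (d : Dir) : Fin 2 := if d.vert then 0 else 1

theorem vec_coaxis (d : Dir) : d.vec d.coaxis = 0 := by
  revert d
  decide

theorem vec_axis (d : Dir) : d.vec d.axis = if d.pos then 1 else -1 := by
  revert d
  decide

theorem eq_axis_or_eq_coaxis (d : Dir) (i : Fin 2) : i = d.axis ∨ i = d.coaxis := by
  revert d i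
  decide

theorem axis_eq_coaxis_of_ne {d e : Dir} (h : e ≠ d) (h' : e ≠ d.opp) :
    e.axis = d.coaxis ∧ e.coaxis = d.axis := by
  revert d e
  decide

theorem vec_opp (d : Dir) : d.opp.vec = -d.vec := by
  revert d
  decide

theorem vec_axis_ne_zero (d : Dir) : d.vec d.axis ≠ 0 := by
  revert d
  decide

end Dir

theorem exists_forall_not_isSingularLine {x : Config Tile 2} (hx : x ∈ rob.carrier) {i : Fin 2}
    {c : ℤ} (h : ¬ IsSingularLine i x c) :
    ∃ s : Bool, ∀ t : ℕ, ¬ IsSingularLine i x (c + t * if s then 1 else -1) := by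
  by_cases hc : ∃ c', c < c' ∧ IsSingularLine i x c'
  · obtain ⟨c', hlt, hc'⟩ := hc
    refine ⟨false, fun t ht => ?_⟩
    have h_eq := ht.unique hx hc'
    simp only [Bool.false_eq_true, if_false] at h_eq
    omega
  · refine ⟨true, fun t ht => ?_⟩
    rw [if_pos rfl, mul_one] at ht
    rcases Nat.eq_zero_or_pos t with rfl | ht₀
    · exact h (by simpa using ht)
    · exact hc ⟨_, by omega, ht⟩

theorem isSingularLine_coaxis_of_ne {x y : Config Tile 2} (hx : x ∈ rob.carrier)
    (hxy : SamePosition x y) {q : Lattice 2} (hq : x q ≠ y q) {d : Dir}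
    (hd : ¬ IsSingularLine d.axis x (q d.axis)) : IsSingularLine d.coaxis x (q d.coaxis) := by
  obtain ⟨i, hi⟩ := exists_isSingularLine_of_ne hx hxy hq
  rcases d.eq_axis_or_eq_coaxis i with rfl | rfl
  exacts [absurd hi hd, hi]

theorem eq_of_eq_neighbours {x y : Config Tile 2} (hx : x ∈ rob.carrier) (hy : y ∈ rob.carrier)
    {q : Lattice 2} (e : Dir) (h : ∀ d ≠ e, x (q + d.vec) = y (q + d.vec)) : x q = y q :=
  Tile.eq_of_matches e (fun d _ => matches_of_mem_rob hx q d) fun d hd =>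
    h d hd ▸ matches_of_mem_rob hy q d

theorem ne_add_vec_of_ne {x y : Config Tile 2} (hx : x ∈ rob.carrier) (hy : y ∈ rob.carrier)
    (hxy : SamePosition x y) {q : Lattice 2} (hq : x q ≠ y q) {d : Dir}
    (hd : ¬ IsSingularLine d.axis x (q d.axis)) : x (q + d.vec) ≠ y (q + d.vec) := by
  intro h_eq
  refine hq (eq_of_eq_neighbours hx hy d.opp fun e he => ?_)
  by_cases hed : e = d
  · rwa [hed]
  by_contra hne
  obtain ⟨h_axis, h_coaxis⟩ := Dir.axis_eq_coaxis_of_ne hed he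
  have vec_axis : e.vec d.axis = 0 := h_coaxis ▸ e.vec_coaxis
  have vec_coaxis : e.vec d.coaxis ≠ 0 := h_axis ▸ e.vec_axis_ne_zero
  have h_line := isSingularLine_coaxis_of_ne hx hxy hne (d := d) <| by
    rwa [Pi.add_apply, vec_axis, add_zero]
  exact vec_coaxis (add_eq_left.1 (h_line.unique hx (isSingularLine_coaxis_of_ne hx hxy hq hd)))

theorem exists_ray_of_not_isSingularLine {x y : Config Tile 2} (hx : x ∈ rob.carrier)
    (hy : y ∈ rob.carrier) (hxy : SamePosition x y) {q : Lattice 2} (hq : x q ≠ y q) (d₀ : Dir)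
    (hd₀ : ¬ IsSingularLine d₀.axis x (q d₀.axis)) :
    ∃ d : Dir, IsSingularLine d.coaxis x (q d.coaxis) ∧
      ∀ t : ℕ, x (q + (t : ℤ) • d.vec) ≠ y (q + (t : ℤ) • d.vec) := by
  obtain ⟨s, hs⟩ := exists_forall_not_isSingularLine hx hd₀
  let d : Dir := ⟨d₀.vert, s⟩
  have not_line (t : ℕ) : ¬ IsSingularLine d.axis x ((q + (t : ℤ) • d.vec) d.axis) := by
    rw [Pi.add_apply, Pi.smul_apply, d.vec_axis]
    exact hs t
  refine ⟨d, isSingularLine_coaxis_of_ne hx hxy hq hd₀, fun t => ?_⟩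
  induction t with
  | zero => simpa using hq
  | succ t ih =>
    rw [Nat.cast_succ, add_one_zsmul, ← add_assoc]
    exact ne_add_vec_of_ne hx hy hxy ih (not_line t)

theorem exists_ray {x y : Config Tile 2} (hx : x ∈ rob.carrier) (hy : y ∈ rob.carrier)
    (hxy : SamePosition x y) (hne : x ≠ y) :
    ∃ (d : Dir) (q : Lattice 2), IsSingularLine d.coaxis x (q d.coaxis) ∧
      ∀ t : ℕ, x (q + (t : ℤ) • d.vec) ≠ y (q + (t : ℤ) • d.vec) := by
  suffices ∃ (q : Lattice 2) (d : Dir), x q ≠ y q ∧ ¬ IsSingularLine d.axis x (q d.axis) by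
    obtain ⟨q, d₀, hq, hd₀⟩ := this
    obtain ⟨d, hd⟩ := exists_ray_of_not_isSingularLine hx hy hxy hq d₀ hd₀
    exact ⟨d, q, hd⟩
  obtain ⟨q, hq⟩ := Function.ne_iff.1 hne
  by_cases h_line : ∃ d : Dir, ¬ IsSingularLine d.axis x (q d.axis)
  · obtain ⟨d, hd⟩ := h_line
    exact ⟨q, d, hq, hd⟩
  · push Not at h_line
    obtain ⟨d, hd⟩ : ∃ d : Dir, x (q + d.vec) ≠ y (q + d.vec) := by
      by_contra! h
      exact hq (eq_of_eq_neighbours hx hy ⟨true, true⟩ fun d _ => h d)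
    exact ⟨q + d.vec, d, hd, fun h =>
      d.vec_axis_ne_zero (add_eq_left.1 (h.unique hx (h_line d)))⟩

/-! ### The extended symmetries -/

theorem exists_mulVec_mem_box {d : ℕ} (B : Matrix (Fin d) (Fin d) ℤ) (K : ℕ) :
    ∃ C, ∀ p ∈ box d K, B *ᵥ p ∈ box d C := by
  choose N hN using exists_mem_box (d := d)
  refine ⟨(finite_box K).toFinset.sup fun p => N (B *ᵥ p), fun p hp => ?_⟩
  have h_le := Finset.le_sup (f := fun p => N (B *ᵥ p)) ((finite_box K).mem_toFinset.2 hp)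
  exact box_mono h_le (hN _)

theorem HasPosition.shift {n : ℕ} {x : Config Tile 2} {u : Lattice 2} (h : HasPosition n x u)
    (v : Lattice 2) : HasPosition n (shift v x) (u - v) := fun p hp => by
  rw [sub_add_eq_add_sub, add_sub_assoc] at hp ⊢
  exact h _ hp

theorem IsCentered.hasPosition {x : Config Tile 2} (hx : IsCentered x) (n : ℕ) :
    HasPosition n x 0 := fun p hp => by
  rw [zero_add] at hp ⊢
  exact hx p fun i => ne_zero_of_not_dvd (hp i)

theorem shift_injective_of_mem_rob {x : Config Tile 2} (hx : x ∈ rob.carrier) :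
    Function.Injective fun v : Lattice 2 => shift v x := fun v w (h : shift v x = shift w x) => by
  ext i
  refine eq_of_forall_two_pow_dvd_sub fun n => ?_
  obtain ⟨u, hu⟩ := exists_hasPosition hx n
  have hd := (h ▸ hu.shift v).unique (hu.shift w) i
  rw [Pi.sub_apply, Pi.sub_apply, sub_sub_sub_cancel_left] at hd
  exact (pow_dvd_pow 2 (Nat.le_add_right n 3)).trans hd

theorem IsCentered.shift_unique {x : Config Tile 2} {v w : Lattice 2}
    (hv : IsCentered (shift v x)) (hw : IsCentered (shift w x)) : v = w := by
  have position {v : Lattice 2} (hv : IsCentered (Robinson.shift v x)) (n : ℕ) :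
      HasPosition n x v := by
    simpa only [shift_neg_shift, sub_neg_eq_add, zero_add] using (hv.hasPosition n).shift (-v)
  ext i
  exact eq_of_forall_two_pow_dvd_sub fun n =>
    (pow_dvd_pow 2 (Nat.le_add_right n 3)).trans ((position hw n).unique (position hv n) i)

theorem isCentered_shift_of_isSingularLine {x : Config Tile 2} (hx : x ∈ rob.carrier)
    {w : Lattice 2} (h : ∀ i, IsSingularLine i x (w i)) : IsCentered (shift (-w) x) := by
  intro p hp
  obtain ⟨n, hn⟩ := exists_mem_box p
  obtain ⟨u, hu⟩ := exists_hasPosition hx n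
  have h_sub (i : Fin 2) : 2 ^ (n + 2) ∣ (u + (p - -w)) i - p i := by
    convert h i n u hu using 1
    simp only [Pi.add_apply, Pi.sub_apply, Pi.neg_apply]
    ring
  have not_dvd (i : Fin 2) : ¬ 2 ^ (n + 1) ∣ p i := fun hd =>
    not_two_pow_dvd_of_mem_box hn (hp i) ((pow_dvd_pow 2 n.le_succ).trans hd)
  calc x (p - -w) = hier (u + (p - -w)) := hu _ fun i hd =>
        not_dvd i ((pow_dvd_pow 2 (Nat.le_succ _)).trans ((dvd_iff_dvd_of_dvd_sub (h_sub i)).1 hd))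
    _ = hier p := hier_congr not_dvd h_sub

theorem samePosition_apply {M : GL (Fin 2) ℤ} {f : rob.carrier → rob.carrier}
    (hc : Continuous f) (hf : rob.IsMorphism M f) {x y : rob.carrier} (hx : IsCentered x.1)
    (hy : IsCentered y.1) : SamePosition (f x).1 (f y).1 := by
  intro n u hu
  obtain ⟨R, hR⟩ := rob.exists_hasRadius hc
  obtain ⟨C, hC⟩ := exists_mulVec_mem_box (M⁻¹).1 (2 ^ (n + 2))
  obtain ⟨u', hu'⟩ := exists_hasPosition (f y).2 n
  -- The images agree on the square at `M *ᵥ s`, whose preimage is far from the axes.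
  let s : Lattice 2 := fun _ => C + R + 1
  refine hu'.congr (hu'.unique_of_agree hu (c := M.1 *ᵥ s) fun p hp => ?_)
  by_contra hne
  obtain ⟨w, hw, hxy⟩ := hR.exists_ne_of_apply_ne hf hne
  have h_eq : (M⁻¹).1 *ᵥ p = s + (M⁻¹).1 *ᵥ (p - M.1 *ᵥ s) := by
    rw [mulVec_sub, mulVec_mulVec, ← Units.val_mul, inv_mul_cancel, Units.val_one, one_mulVec,
      add_sub_cancel]
  have mem_box : (M⁻¹).1 *ᵥ (p - M.1 *ᵥ s) ∈ box 2 C := hC _ fun i => by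
    have := hp i
    rw [Set.mem_Ico] at this
    rw [Pi.sub_apply, abs_of_nonneg (by omega)]
    push_cast
    omega
  have off_axes (i : Fin 2) : ((M⁻¹).1 *ᵥ p + w) i ≠ 0 := by
    have := abs_le.1 (mem_box i)
    have := abs_le.1 (hw i)
    rw [h_eq, Pi.add_apply, Pi.add_apply, show s i = C + R + 1 from rfl]
    omega
  exact hxy ((hy _ off_axes).trans (hx _ off_axes).symm)

theorem eq_zero_of_forall_abs_add_mul_le {a b : ℤ} {R : ℕ} (h : ∀ t : ℕ, |a + t * b| ≤ R) :
    b = 0 := by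
  have h_abs : |(2 * R + 1) * b| < 2 * R + 1 := by
    have := abs_le.1 (h 0)
    have := abs_le.1 (h (2 * R + 1))
    rw [abs_lt]
    push_cast at this
    omega
  exact (mul_eq_zero.1 (Int.eq_zero_of_abs_lt_dvd (dvd_mul_right _ _) h_abs)).resolve_left
    (by positivity)

theorem exists_isSingularLine_apply {M : GL (Fin 2) ℤ} {f : rob.carrier ≃ₜ rob.carrier}
    (hf : rob.IsMorphism M f) (j : Fin 2) {x y : rob.carrier} (hx : IsCentered x.1)
    (hy : IsCentered y.1) (hne : x ≠ y) (hj : ∀ p : Lattice 2, p j ≠ 0 → x.1 p = y.1 p) :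
    ∃ (d : Dir) (c : ℤ), IsSingularLine d.coaxis (f x).1 c ∧ ((M⁻¹).1 *ᵥ d.vec) j = 0 := by
  obtain ⟨R, hR⟩ := rob.exists_hasRadius f.continuous
  obtain ⟨d, q, h_line, h_ray⟩ := exists_ray (f x).2 (f y).2
    (samePosition_apply f.continuous hf hx hy) fun h => hne (f.injective (Subtype.ext h))
  -- The preimage of the ray stays within distance `R` of the line on which `x` and `y` differ.
  refine ⟨d, _, h_line, eq_zero_of_forall_abs_add_mul_le (a := ((M⁻¹).1 *ᵥ q) j) (R := R)
    fun t => ?_⟩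
  obtain ⟨w, hw, hxy⟩ := hR.exists_ne_of_apply_ne hf (h_ray t)
  have h_zero : ((M⁻¹).1 *ᵥ (q + (t : ℤ) • d.vec) + w) j = 0 := not_not.1 fun h => hxy (hj _ h)
  rw [mulVec_add, mulVec_smul] at h_zero
  rw [show _ + _ * _ = -w j from eq_neg_of_add_eq_zero_left h_zero, abs_neg]
  exact hw j

theorem exists_dir_of_mulVec_inv_eq_zero {M : GL (Fin 2) ℤ} {i j : Fin 2} (hij : i ≠ j) {d : Dir}
    (h : ((M⁻¹).1 *ᵥ d.vec) j = 0) :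
    ∃ d' : Dir, d'.vert = d.vert ∧ M.1 *ᵥ Pi.single i 1 = d'.vec := by
  obtain ⟨c, hc⟩ : ∃ c : ℤ, (M⁻¹).1 *ᵥ d.vec = c • (Pi.single i 1 : Lattice 2) := by
    refine ⟨((M⁻¹).1 *ᵥ d.vec) i, funext fun l => ?_⟩
    rcases eq_or_ne l i with rfl | hl
    · simp
    · obtain rfl : l = j := by omega
      rw [h, Pi.smul_apply, Pi.single_eq_of_ne hl, smul_zero]
  have h_vec : d.vec = c • (M.1 *ᵥ Pi.single i 1) := by
    rw [← mulVec_smul, ← hc, mulVec_mulVec, ← Units.val_mul, mul_inv_cancel, Units.val_one,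
      one_mulVec]
  have c_unit : IsUnit c := by
    have h_axis : c * (M.1 *ᵥ Pi.single i 1) d.axis = if d.pos then 1 else -1 :=
      (congrFun h_vec d.axis).symm.trans d.vec_axis
    refine isUnit_of_mul_isUnit_left (y := (M.1 *ᵥ Pi.single i 1) d.axis) ?_
    rw [h_axis, Int.isUnit_iff]
    exact ite_eq_or_eq _ _ _
  rcases Int.isUnit_iff.1 c_unit with rfl | rfl
  · exact ⟨d, rfl, by rw [h_vec, one_smul]⟩
  · exact ⟨d.opp, rfl, by rw [d.vec_opp, h_vec, neg_smul, one_smul, neg_neg]⟩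

theorem exists_dihedralMatrix_eq : ∀ a b : Dir, a.vert ≠ b.vert →
    ∃ g : DihedralGroup 4, dihedralMatrix g = !![a.vec 0, b.vec 0; a.vec 1, b.vec 1] := by
  decide

theorem det_vec_eq_zero : ∀ a b : Dir, a.vert = b.vert →
    a.vec 0 * b.vec 1 - b.vec 0 * a.vec 1 = 0 := by
  decide

theorem eq_dihedralMatrix_of_mulVec_eq_vec {M : GL (Fin 2) ℤ} {a b : Dir}
    (ha : M.1 *ᵥ Pi.single 0 1 = a.vec) (hb : M.1 *ᵥ Pi.single 1 1 = b.vec) :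
    a.vert ≠ b.vert ∧ ∃ g, M = dihedralMatrix.toHomUnits g := by
  have hM : M.1 = !![a.vec 0, b.vec 0; a.vec 1, b.vec 1] := by
    rw [mulVec_single_one] at ha hb
    rw [← ha, ← hb]
    exact eta_fin_two M.1
  have h_vert : a.vert ≠ b.vert := fun h => by
    have h_det := (isUnit_iff_isUnit_det _).1 M.isUnit
    rw [hM, det_fin_two_of, det_vec_eq_zero a b h] at h_det
    exact not_isUnit_zero h_det
  obtain ⟨g, hg⟩ := exists_dihedralMatrix_eq a b h_vert
  exact ⟨h_vert, g, Units.ext (hM.trans hg.symm)⟩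

theorem exists_forall_isSingularLine {x : Config Tile 2} {d d' : Dir} {c c' : ℤ}
    (h : IsSingularLine d.coaxis x c) (h' : IsSingularLine d'.coaxis x c')
    (hd : d.vert ≠ d'.vert) : ∃ w : Lattice 2, ∀ i, IsSingularLine i x (w i) := by
  rcases d with ⟨_ | _, _⟩ <;> rcases d' with ⟨_ | _, _⟩
  · exact absurd rfl hd
  · exact ⟨![c', c], Fin.forall_fin_two.2 ⟨h', h⟩⟩
  · exact ⟨![c, c'], Fin.forall_fin_two.2 ⟨h, h'⟩⟩
  · exact absurd rfl hd

/-- The symmetry `f` acts on the plane as the affine map `v ↦ g v + w`: its linear part is `g`, and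
it moves the singular point of the hierarchy at the origin to `w`. -/
structure HasAffinePart (f : rob.carrier ≃ₜ rob.carrier) (g : DihedralGroup 4) (w : Lattice 2) :
    Prop where
  isMorphism : rob.IsMorphism (dihedralMatrix.toHomUnits g) f
  isCentered_apply (y : rob.carrier) : IsCentered y.1 → IsCentered (shift (-w) (f y).1)

theorem exists_dir_of_isMorphism {M : GL (Fin 2) ℤ} {f : rob.carrier ≃ₜ rob.carrier}
    (hf : rob.IsMorphism M f) {i j : Fin 2} (hij : i ≠ j) {x y z : rob.carrier}
    (hx : IsCentered x.1) (hy : IsCentered y.1) (hz : IsCentered z.1) (hne : x ≠ y)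
    (hj : ∀ p : Lattice 2, p j ≠ 0 → x.1 p = y.1 p) :
    ∃ (a d : Dir) (c : ℤ), a.vert = d.vert ∧ M.1 *ᵥ Pi.single i 1 = a.vec ∧
      IsSingularLine d.coaxis (f z).1 c := by
  obtain ⟨d, c, h_line, h_zero⟩ := exists_isSingularLine_apply hf j hx hy hne hj
  obtain ⟨a, h_vert, ha⟩ := exists_dir_of_mulVec_inv_eq_zero hij h_zero
  exact ⟨a, d, c, h_vert, ha, fun n u hu =>
    h_line n u (samePosition_apply f.continuous hf hz hx n u hu)⟩

theorem exists_hasAffinePart {f : rob.carrier ≃ₜ rob.carrier} (hf : f ∈ rob.Sym) :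
    ∃ g w, HasAffinePart f g w := by
  obtain ⟨M, hM⟩ := hf
  let x (e : Bool) : rob.carrier := ⟨rowPoint e, rowPoint_mem e⟩
  let y (e : Bool) : rob.carrier := isReflection_swap.homeo (x e)
  have hx (e : Bool) : IsCentered (x e).1 := isCentered_rowPoint e
  have hy (e : Bool) : IsCentered (y e).1 := isReflection_swap.isCentered_reflect (hx e)
  have x_ne : x true ≠ x false := fun h => rowPoint_true_ne_false (congrArg Subtype.val h)
  obtain ⟨a, d, c, h_vert, ha, h_line⟩ := exists_dir_of_isMorphism hM (i := 0) (j := 1)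
    zero_ne_one (hx true) (hx false) (hx true) x_ne fun p hp => rowPoint_eq_of_ne_zero _ _ hp
  obtain ⟨b, d', c', h_vert', hb, h_line'⟩ := exists_dir_of_isMorphism hM (i := 1) (j := 0)
    one_ne_zero (hy true) (hy false) (hx true) (isReflection_swap.homeo.injective.ne x_ne)
    fun p hp => congrArg Tile.swap (rowPoint_eq_of_ne_zero _ _ (by rwa [swapMatrix_mulVec]))
  obtain ⟨hab, g, rfl⟩ := eq_dihedralMatrix_of_mulVec_eq_vec ha hb
  obtain ⟨w, hw⟩ := exists_forall_isSingularLine h_line h_line' (h_vert ▸ h_vert' ▸ hab)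
  refine ⟨g, w, hM, fun z hz => isCentered_shift_of_isSingularLine (f z).2 fun i n u hu => ?_⟩
  exact hw i n u (samePosition_apply f.continuous hM hz (hx true) n u hu)

theorem dihedralMatrix_injective : Function.Injective dihedralMatrix := by
  unfold Function.Injective
  decide

namespace HasAffinePart

variable {f f' : rob.carrier ≃ₜ rob.carrier} {g g' : DihedralGroup 4} {w w' : Lattice 2}

theorem unique (h : HasAffinePart f g w) (h' : HasAffinePart f g' w') : g = g' ∧ w = w' := by
  let x : rob.carrier := ⟨rowPoint true, rowPoint_mem true⟩
  have hx : IsCentered x.1 := isCentered_rowPoint true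
  constructor
  · refine dihedralMatrix_injective (mulVec_injective (funext fun v => ?_))
    exact shift_injective_of_mem_rob (f x).2
      (congrArg Subtype.val ((h.isMorphism v x).symm.trans (h'.isMorphism v x)))
  · exact neg_injective
      (IsCentered.shift_unique (h.isCentered_apply x hx) (h'.isCentered_apply x hx))

theorem mul (h : HasAffinePart f g w) (h' : HasAffinePart f' g' w') :
    HasAffinePart (f * f') (g * g') (w + dihedralMatrix g *ᵥ w') where
  isMorphism v x := by
    rw [map_mul, Units.val_mul, ← mulVec_mulVec]
    exact (congrArg f (h'.isMorphism v x)).trans (h.isMorphism _ _)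
  isCentered_apply y hy := by
    let z : rob.carrier := rob.shiftMap (-w') (f' y)
    have hz : f' y = rob.shiftMap w' z := Subtype.ext (shift_shift_neg w' (f' y).1).symm
    have h_apply : ((f * f') y).1 = shift (dihedralMatrix g *ᵥ w') (f z).1 :=
      congrArg Subtype.val ((congrArg f hz).trans (h.isMorphism w' z))
    rw [h_apply, shift_shift, neg_add, neg_add_cancel_right]
    exact h.isCentered_apply z (h'.isCentered_apply y hy)

theorem eq_one (h : HasAffinePart f 1 0) : f = 1 := by
  have commutes (v : Lattice 2) (x : rob.carrier) :
      f (rob.shiftMap v x) = rob.shiftMap v (f x) := by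
    rw [h.isMorphism, map_one, Units.val_one, one_mulVec]
  obtain ⟨R, hR⟩ := rob.exists_hasRadius f.continuous
  let x : rob.carrier := ⟨rowPoint true, rowPoint_mem true⟩
  have hx : IsCentered x.1 := isCentered_rowPoint true
  have hfx : IsCentered (f x).1 := by
    have := h.isCentered_apply x hx
    rwa [neg_zero, shift_zero] at this
  -- Near the origin every `y` looks like a shift of `x`, and `f x` agrees with `x` off the axes.
  have apply_zero (y : rob.carrier) : (f y).1 0 = y.1 0 := by
    obtain ⟨u, hu⟩ := y.2 R
    have h_agree : Set.EqOn y.1 (rob.shiftMap (-u) x).1 (box 2 R) := fun p hp => by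
      obtain ⟨h_ne, h_eq⟩ := hu p hp
      simp only [Subshift.shiftMap, shift]
      rw [h_eq, sub_neg_eq_add, add_comm p, hx _ h_ne]
    obtain ⟨h_ne, h_eq⟩ := hu 0 fun i => by simp
    rw [hR _ _ h_agree, commutes, h_eq, ← hfx _ h_ne]
    simp only [Subshift.shiftMap, shift, sub_neg_eq_add, zero_add, add_zero]
  refine Homeomorph.ext fun y => Subtype.ext (funext fun q => ?_)
  have h_shift := apply_zero (rob.shiftMap (-q) y)
  rw [commutes] at h_shift
  simp only [Subshift.shiftMap, shift, sub_neg_eq_add, zero_add] at h_shift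
  exact h_shift

end HasAffinePart

theorem hasAffinePart_one : HasAffinePart 1 1 0 where
  isMorphism v x := by simp
  isCentered_apply y hy := by rwa [neg_zero, shift_zero]

theorem hasAffinePart_shiftHomeo (w : Lattice 2) : HasAffinePart (rob.shiftHomeo w) 1 w where
  isMorphism v x := Subtype.ext (by
    rw [map_one, Units.val_one, one_mulVec]
    change shift w (shift v x.1) = shift v (shift w x.1)
    rw [shift_shift, shift_shift, add_comm])
  isCentered_apply y hy := by
    change IsCentered (shift (-w) (shift w y.1))
    rwa [shift_neg_shift]

theorem IsReflection.hasAffinePart_homeo {B : Matrix (Fin 2) (Fin 2) ℤ} {φ : Tile → Tile}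
    (h : IsReflection B φ) {g : DihedralGroup 4} (hg : dihedralMatrix g = B) :
    HasAffinePart h.homeo g 0 where
  isMorphism v x := Subtype.ext (by
    rw [show (dihedralMatrix.toHomUnits g).1 = B from hg]
    exact h.reflect_shift v x.1)
  isCentered_apply y hy := by
    rw [neg_zero, shift_zero]
    exact h.isCentered_reflect hy

theorem exists_hasAffinePart_linear (g : DihedralGroup 4) : ∃ f, HasAffinePart f g 0 := by
  have mul {g g' : DihedralGroup 4} :
      (∃ f, HasAffinePart f g 0) → (∃ f, HasAffinePart f g' 0) →
        ∃ f, HasAffinePart f (g * g') 0 := by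
    rintro ⟨f, hf⟩ ⟨f', hf'⟩
    exact ⟨f * f', by simpa using hf.mul hf'⟩
  have mirror : ∃ f, HasAffinePart f (.sr 0) 0 :=
    ⟨_, isReflection_mirror.hasAffinePart_homeo (by decide)⟩
  have rotation (i : ZMod 4) : ∃ f, HasAffinePart f (.r i) 0 := by
    have quarter_turn : ∃ f, HasAffinePart f (.r 1) 0 :=
      mul mirror ⟨_, isReflection_swap.hasAffinePart_homeo (g := .sr 1) (by decide)⟩
    have power (n : ℕ) : ∃ f, HasAffinePart f (.r 1 ^ n) 0 := by
      induction n with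
      | zero => exact ⟨1, hasAffinePart_one⟩
      | succ n ih => exact pow_succ (.r 1 : DihedralGroup 4) n ▸ mul ih quarter_turn
    have h_power := power i.val
    rwa [DihedralGroup.r_one_pow, ZMod.natCast_zmod_val] at h_power
  cases g with
  | r i => exact rotation i
  | sr i => simpa using mul mirror (rotation i)

theorem exists_hasAffinePart_eq (g : DihedralGroup 4) (w : Lattice 2) :
    ∃ f, HasAffinePart f g w := by
  obtain ⟨f, hf⟩ := exists_hasAffinePart_linear g
  exact ⟨rob.shiftHomeo w * f, by simpa using (hasAffinePart_shiftHomeo w).mul hf⟩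

theorem nonempty_sym_mulEquiv : Nonempty (rob.Sym ≃*
    Multiplicative (Lattice 2) ⋊[dihedralAction] DihedralGroup 4) := by
  choose g w h using fun f : rob.Sym => exists_hasAffinePart f.2
  let toAffine : rob.Sym →* Multiplicative (Lattice 2) ⋊[dihedralAction] DihedralGroup 4 :=
    MonoidHom.mk' (fun f => ⟨Multiplicative.ofAdd (w f), g f⟩) fun f f' => by
      obtain ⟨hg, hw⟩ := (h (f * f')).unique ((h f).mul (h f'))
      rw [hg, hw]
      rfl
  refine ⟨MulEquiv.ofBijective toAffine ⟨?_, ?_⟩⟩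
  · refine (injective_iff_map_eq_one toAffine).2 fun f hf => Subtype.ext (HasAffinePart.eq_one ?_)
    have hw : w f = 0 := congrArg (fun s => s.left.toAdd) hf
    have hg : g f = 1 := congrArg (fun s => s.right) hf
    exact hw ▸ hg ▸ h f
  · rintro ⟨v, k⟩
    obtain ⟨f, hf⟩ := exists_hasAffinePart_eq k v.toAdd
    let f' : rob.Sym := ⟨f, _, hf.isMorphism⟩
    obtain ⟨hg, hw⟩ := (h f').unique hf
    exact ⟨f', SemidirectProduct.ext (congrArg Multiplicative.ofAdd hw) hg⟩

end Robinson

theorem mainTheorem7 :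
    (∃! M : Robinson.Subshift Robinson.Tile 2,
      M.IsMinimal ∧ M.carrier ⊆ Robinson.robinsonShift) ∧
    ∀ M : Robinson.Subshift Robinson.Tile 2,
      M.IsMinimal → M.carrier ⊆ Robinson.robinsonShift →
        Nonempty (M.Sym ≃*
          Multiplicative (Robinson.Lattice 2) ⋊[Robinson.dihedralAction] DihedralGroup 4) := by
  refine ⟨⟨Robinson.rob, ⟨Robinson.rob_isMinimal, Robinson.rob_subset_robinsonShift⟩,
    fun M hM => Robinson.eq_rob_of_isMinimal hM.1 hM.2⟩, fun M hM hsub => ?_⟩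
  rw [Robinson.eq_rob_of_isMinimal hM hsub]
  exact Robinson.nonempty_sym_mulEquiv
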